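/- Let $A$ and $B$ be unital complex Banach algebras ($B$ not necessarily commutative), and let $\varphi:A\to\mathbb{C}$ and $\Phi:A\to B$ be unital linear maps. Let $X,Y\in A$ be c-free with respect to $(\Phi,\varphi)$: whenever $n\ge 1$ and $a_1,\dots,a_n$ are elements with $\varphi(a_j)=0$, taken alternately from the unital subalgebras of $A$ generated by $X$ and by $Y$ (consecutive elements come from different ones of the two subalgebras), we have $\varphi(a_1\cdots a_n)=0$ and $\Phi(a_1\cdots a_n)=\Phi(a_1)\cdots\Phi(a_n)$. Let $NC(n)$ be the set of non-crossing partitions of $\{1,\dots,n\}$. A block $C$ of $\gamma\in NC(n)$ is interior if there are another block $D$ of $\gamma$ and $i,j\in D$ with $i<p<j$ for all $p\in C$, and exterior otherwise. The free cumulants $\kappa_n(X_1,\dots,X_n)\in\mathbb{C}$ and the c-free cumulants ${}^c\kappa_n(X_1,\dots,X_n)\in B$ are defined recursively by $$\varphi(X_1\cdots X_n)=\sum_{\gamma\in NC(n)}\ \prod_{C=(i_1<\dots<i_l)\in\gamma}\kappa_l(X_{i_1},\dots,X_{i_l}),$$ $$\Phi(X_1\cdots X_n)=\sum_{\gamma\in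 NC(n)}\Big[\prod_{\substack{C=(j_1<\dots<j_l)\\ C\text{ exterior in }\gamma}}{}^c\kappa_l(X_{j_1},\dots,X_{j_l})\Big]\cdot\Big[\prod_{\substack{D=(i_1<\dots<i_s)\\ D\text{ interior in }\gamma}}\kappa_s(X_{i_1},\dots,X_{i_s})\Big],$$ where the product over the exterior blocks is taken in increasing order of their first elements. Write $\kappa_n(X)=\kappa_n(X,\dots,X)$ and ${}^c\kappa_n(X)={}^c\kappa_n(X,\dots,X)$. For $\gamma\in NC(n)$, let $\gamma[p]$ be the block of $\gamma$ containing $p$, and let the Kreweras complement $Kr(\gamma)$ be the biggest (coarsest) non-crossing partition of $\{\bar 1,\dots,\bar n\}$ such that $\gamma\cup Kr(\gamma)$ is a non-crossing partition of $1<\bar 1<2<\bar 2<\dots<n<\bar n$. Then for every $n\ge 1$: (i) $\displaystyle \kappa_n(XY)=\sum_{\gamma\in NC(n)}\ \prod_{C\in\gamma}\kappa_{|C|}(X)\cdot\prod_{D\in Kr(\gamma)}\kappa_{|D|}(Y);$ (ii) $\displaystyle {}^c\kappa_n(XY)=\sum_{\gamma\in NC(n)}{}^c\kappa_{|\gamma[1]|}(X)\cdot{}^c\kappa_{|Kr(\gamma)[\bar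 n]|}(Y)\cdot\prod_{\substack{C\in\gamma\\ C\ne\gamma[1]}}\kappa_{|C|}(X)\cdot\prod_{\substack{D\in Kr(\gamma)\\ D\ne Kr(\gamma)[\bar n]}}\kappa_{|D|}(Y).$ -/

import Mathlib

noncomputable section

namespace CFree

/-! ### Non-crossing partitions -/

/-- A family of blocks of a linearly ordered set is non-crossing if there are no two distinct
blocks `C`, `D` and no `i < k < p < q` with `i, p ∈ C` and `k, q ∈ D`. -/
def NonCrossing {α : Type*} [LinearOrder α] (P : Finset (Finset α)) : Prop :=
  ∀ C ∈ P, ∀ D ∈ P, C ≠ D →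
    ∀ i k p q : α, i < k → k < p → p < q → ¬ (i ∈ C ∧ p ∈ C ∧ k ∈ D ∧ q ∈ D)

/-- `NC n`: the non-crossing partitions of an ordered set with `n` elements, here
`Fin n = {0, …, n - 1}` (so that the positions `1, …, n` are shifted by one).
It carries the order of `Finpartition`: `σ ≤ π` iff every block of `σ` is contained in a block
of `π`, so that the one-block partition is the biggest element. -/
abbrev NC (n : ℕ) : Type :=
  {π : Finpartition (Finset.univ : Finset (Fin n)) // NonCrossing π.parts}

instance (n : ℕ) : Fintype (NC n) := by
  classical exact Subtype.fintype _

/-- The set of blocks of a non-crossing partition. -/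
def NC.blocks {n : ℕ} (π : NC n) : Finset (Finset (Fin n)) := π.1.parts

/-- `π.block p` is the block `π[p]` of `π` containing `p`. -/
def NC.block {n : ℕ} (π : NC n) (p : Fin n) : Finset (Fin n) := π.1.part p

/-- A block `C` of `π` is interior if there are another block `D` and `i, j ∈ D` such that
every element of `C` lies strictly between `i` and `j`. -/
def NC.IsInterior {n : ℕ} (π : NC n) (C : Finset (Fin n)) : Prop :=
  ∃ D ∈ π.blocks, D ≠ C ∧ ∃ i ∈ D, ∃ j ∈ D, ∀ p ∈ C, i < p ∧ p < j

open Classical in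
/-- The set of interior blocks. -/
def NC.intBlocks {n : ℕ} (π : NC n) : Finset (Finset (Fin n)) :=
  π.blocks.filter fun C => π.IsInterior C

open Classical in
/-- The exterior (that is, non-interior) blocks, listed without repetition in increasing order of
their first elements. -/
def NC.extBlocks {n : ℕ} (π : NC n) : List (Finset (Fin n)) :=
  ((List.finRange n).filter fun i =>
    (∀ p ∈ π.block i, i ≤ p) ∧ ¬ π.IsInterior (π.block i)).map π.block

/-! ### The Kreweras complement

The ordered set `1 < 1̄ < 2 < 2̄ < ⋯ < n < n̄` is realised inside `ℕ` by putting the `i`-th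
unbarred element at position `2 * i` and the `i`-th barred one at `2 * i + 1`. -/

/-- The family of blocks `π ∪ σ` on `1 < 1̄ < 2 < 2̄ < ⋯ < n < n̄`, where `σ` is regarded as a
partition of the barred elements. -/
def interleave {n : ℕ} (π σ : NC n) : Finset (Finset ℕ) :=
  π.blocks.image (fun C => C.image fun i : Fin n => 2 * (i : ℕ)) ∪
    σ.blocks.image (fun D => D.image fun i : Fin n => 2 * (i : ℕ) + 1)

/-- There is a biggest non-crossing partition `σ` of the barred elements such that `π ∪ σ` is
non-crossing. -/
theorem exists_kreweras {n : ℕ} (π : NC n) :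
    ∃ σ : NC n, IsGreatest {τ : NC n | NonCrossing (interleave π τ)} σ := by
  classical
  let s : Setoid (Fin n) :=
    { r := fun i j => ∀ C ∈ π.1.parts, ∀ p ∈ C, ∀ q ∈ C,
        ((p ≤ i ↔ p ≤ j) ↔ (q ≤ i ↔ q ≤ j))
      iseqv :=
        { refl := by intro i C _ p _ q _; tauto
          symm := by
            intro i j h C hC p hp q hq
            have := h C hC p hp q hq
            tauto
          trans := by
            intro i j k h h' C hC p hp q hq
            have h1 := h C hC p hp q hq
            have h2 := h' C hC p hp q hq
            tauto } }
  have hs : ∀ i j, s i j ↔ ∀ C ∈ π.1.parts, ∀ p ∈ C, ∀ q ∈ C,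
        ((p ≤ i ↔ p ≤ j) ↔ (q ≤ i ↔ q ≤ j)) := fun i j => Iff.rfl
  have hsame : ∀ C ∈ (Finpartition.ofSetoid s).parts, ∀ i ∈ C, ∀ j ∈ C, s i j := by
    intro C hC i hi j hj
    rw [← (Finpartition.ofSetoid s).part_eq_of_mem hC hi,
      Finpartition.mem_part_ofSetoid_iff_rel] at hj
    exact hj
  have hK : NonCrossing (Finpartition.ofSetoid s).parts := by
    rintro C hC D hD hne i k p q hik hkp hpq ⟨hi, hp, hk, hq⟩
    have h1 := hsame C hC i hi p hp
    have h2 := hsame D hD k hk q hq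
    have h3 : s p k := by
      rw [hs] at h1 h2 ⊢
      intro E hE x hx y hy
      have e1 := h1 E hE x hx y hy
      have e2 := h2 E hE x hx y hy
      clear h1 h2 hsame
      grind
    have : k ∈ C := by
      rw [← (Finpartition.ofSetoid s).part_eq_of_mem hC hp,
        Finpartition.mem_part_ofSetoid_iff_rel]
      exact h3
    exact hne ((Finpartition.ofSetoid s).eq_of_mem_parts hC hD this hk)
  refine ⟨⟨Finpartition.ofSetoid s, hK⟩, ?_, ?_⟩
  · intro C hC D hD hne i k p q hik hkp hpq hmem
    simp only [interleave, NC.blocks, Finset.mem_union, Finset.mem_image] at hC hD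
    rcases hC with ⟨C, hC, rfl⟩ | ⟨C, hC, rfl⟩ <;> rcases hD with ⟨D, hD, rfl⟩ | ⟨D, hD, rfl⟩ <;>
      simp only [Finset.mem_image] at hmem <;>
      obtain ⟨⟨i, hi, rfl⟩, ⟨p, hp, rfl⟩, ⟨k, hk, rfl⟩, ⟨q, hq, rfl⟩⟩ := hmem
    · exact π.2 C hC D hD (by rintro rfl; exact hne rfl) i k p q (by omega) (by omega)
        (by omega) ⟨hi, hp, hk, hq⟩
    · have h := hsame D hD k hk q hq C hC i hi p hp
      simp only [Fin.le_def] at h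
      omega
    · have h := hsame C hC i hi p hp D hD k hk q hq
      simp only [Fin.le_def] at h
      omega
    · exact hK C hC D hD (by rintro rfl; exact hne rfl) i k p q (by omega) (by omega)
        (by omega) ⟨hi, hp, hk, hq⟩
  · intro σ hσ
    have key : ∀ D ∈ σ.1.parts, ∀ i ∈ D, ∀ j ∈ D, i < j → s i j := by
      intro D hD i hi j hj hij C hC
      have hCm : C.image (fun i : Fin n => 2 * (i : ℕ)) ∈ interleave π σ := by
        simp only [interleave, NC.blocks, Finset.mem_union, Finset.mem_image]
        exact Or.inl ⟨C, hC, rfl⟩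
      have hDm : D.image (fun i : Fin n => 2 * (i : ℕ) + 1) ∈ interleave π σ := by
        simp only [interleave, NC.blocks, Finset.mem_union, Finset.mem_image]
        exact Or.inr ⟨D, hD, rfl⟩
      have hne : C.image (fun i : Fin n => 2 * (i : ℕ)) ≠
          D.image (fun i : Fin n => 2 * (i : ℕ) + 1) := by
        intro h
        have : 2 * (i : ℕ) + 1 ∈ C.image (fun i : Fin n => 2 * (i : ℕ)) := by
          rw [h]; exact Finset.mem_image_of_mem _ hi
        simp only [Finset.mem_image] at this
        obtain ⟨x, _, hx⟩ := this
        omega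
      have mC : ∀ x ∈ C, 2 * (x : ℕ) ∈ C.image (fun i : Fin n => 2 * (i : ℕ)) :=
        fun x hx => Finset.mem_image_of_mem _ hx
      have mD : ∀ x ∈ D, 2 * (x : ℕ) + 1 ∈ D.image (fun i : Fin n => 2 * (i : ℕ) + 1) :=
        fun x hx => Finset.mem_image_of_mem (fun i : Fin n => 2 * (i : ℕ) + 1) hx
      have sep : ∀ p ∈ C, ∀ q ∈ C, i < p → p ≤ j → (i < q ∧ q ≤ j) := by
        intro p hp q hq hip hpj
        simp only [Fin.lt_def, Fin.le_def] at hip hpj hij ⊢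
        by_contra hcon
        rcases lt_or_ge (i : ℕ) (q : ℕ) with h | h
        · exact hσ _ hDm _ hCm hne.symm _ _ _ _ (by omega) (by omega) (by omega)
            ⟨mD i hi, mD j hj, mC p hp, mC q hq⟩
        · exact hσ _ hCm _ hDm hne _ _ _ _ (by omega) (by omega) (by omega)
            ⟨mC q hq, mC p hp, mD i hi, mD j hj⟩
      intro p hp q hq
      have e1 := sep p hp q hq
      have e2 := sep q hq p hp
      clear sep
      grind
    have key' : ∀ D ∈ σ.1.parts, ∀ i ∈ D, ∀ j ∈ D, s i j := by
      intro D hD i hi j hj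
      rcases lt_trichotomy i j with h | rfl | h
      · exact key D hD i hi j hj h
      · exact s.refl i
      · exact s.symm (key D hD j hj i hi h)
    change σ.1 ≤ Finpartition.ofSetoid s
    intro D hD
    obtain ⟨i, hi⟩ := σ.1.nonempty_of_mem_parts hD
    refine ⟨(Finpartition.ofSetoid s).part i,
      (Finpartition.ofSetoid s).part_mem.2 (Finset.mem_univ i), ?_⟩
    intro j hj
    rw [Finpartition.mem_part_ofSetoid_iff_rel]
    exact key' D hD i hi j hj

/-- The Kreweras complement `Kr(π)`: the biggest non-crossing partition `σ` of
`1̄ < ⋯ < n̄` such that `π ∪ σ` is a non-crossing partition of `1 < 1̄ < ⋯ < n < n̄`. -/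
def Kr {n : ℕ} (π : NC n) : NC n := (exists_kreweras π).choose

theorem isGreatest_Kr {n : ℕ} (π : NC n) :
    IsGreatest {σ : NC n | NonCrossing (interleave π σ)} (Kr π) :=
  (exists_kreweras π).choose_spec

/-! ### Free and c-free cumulants -/

/-- `restrict x C` is the tuple `(x_{i₁}, …, x_{iₗ})` where `i₁ < ⋯ < iₗ` are the elements
of `C`. -/
def restrict {A : Type*} {n : ℕ} (x : Fin n → A) (C : Finset (Fin n)) : Fin C.card → A :=
  fun k => x (C.orderEmbOfFin rfl k)

theorem restrict_univ_ofFn {A B : Type*} {n : ℕ} (f : (m : ℕ) → (Fin m → A) → B) (x : Fin n → A) :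
    f (Finset.univ : Finset (Fin n)).card (restrict x Finset.univ) = f n x := by
  have aux : ∀ (m : ℕ) (h : (Finset.univ : Finset (Fin n)).card = m) (hm : m = n),
      f m (fun k => x (Finset.univ.orderEmbOfFin h k)) = f n x := by
    intro m h hm
    subst hm
    congr 1
    funext k
    have : (Finset.univ.orderEmbOfFin h : Fin m ↪o Fin m) = RelEmbedding.refl _ :=
      (Finset.orderEmbOfFin_unique' h (fun _ => Finset.mem_univ _)).symm
    rw [this]
    rfl
  exact aux _ rfl (by simp)

section Cumulants

variable {A B : Type*} [Ring A] [Algebra ℂ A] [Ring B] [Algebra ℂ B]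

open Classical in
/-- The free cumulant `κ_n(x_1, …, x_n)`, by the moment-cumulant recurrence solved for the term
of the one-block partition. For every partition occurring in the sum all blocks have fewer than
`n` elements, so the test `C.card < n` always succeeds; see `moment_eq_sum_freeCumulant`. -/
def freeCumulant (φ : A →ₗ[ℂ] ℂ) (n : ℕ) (x : Fin n → A) : ℂ :=
  φ (List.ofFn x).prod -
    ∑ γ ∈ Finset.univ.filter (fun γ : NC n => γ.blocks ≠ {Finset.univ}),
      ∏ C ∈ γ.blocks,
        if _h : C.card < n then freeCumulant φ C.card (restrict x C) else 0
termination_by n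

open Classical in
/-- The `B`-valued c-free cumulant `ᶜκ_n(x_1, …, x_n)`, by the recurrence solved for the term of
the one-block partition (whose block is exterior). The product over the exterior blocks is taken
in increasing order of their first elements. As before the test `C.card < n` always succeeds; see
`moment_eq_sum_cFreeCumulant`. -/
def cFreeCumulant (Φ : A →ₗ[ℂ] B) (φ : A →ₗ[ℂ] ℂ) (n : ℕ) (x : Fin n → A) : B :=
  Φ (List.ofFn x).prod -
    ∑ γ ∈ Finset.univ.filter (fun γ : NC n => γ.blocks ≠ {Finset.univ}),
      (∏ D ∈ γ.intBlocks, freeCumulant φ D.card (restrict x D)) •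
        (γ.extBlocks.map fun C =>
          if _h : C.card < n then cFreeCumulant Φ φ C.card (restrict x C) else 0).prod
termination_by n

theorem NC.card_lt {n : ℕ} {γ : NC n} (hγ : γ.blocks ≠ {Finset.univ}) {C : Finset (Fin n)}
    (hC : C ∈ γ.blocks) : C.card < n := by
  classical
  by_contra h
  have hu : C = Finset.univ := by
    apply Finset.eq_univ_of_card
    have := Finset.card_le_univ C
    simp only [Fintype.card_fin] at this ⊢
    omega
  subst hu
  apply hγ
  ext D
  rw [Finset.mem_singleton]
  refine ⟨fun hD => ?_, fun hD => hD ▸ hC⟩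
  obtain ⟨i, hi⟩ := γ.1.nonempty_of_mem_parts hD
  exact γ.1.eq_of_mem_parts hD hC hi (Finset.mem_univ i)

theorem NC.block_mem {n : ℕ} (γ : NC n) (i : Fin n) : γ.block i ∈ γ.blocks :=
  γ.1.part_mem.2 (Finset.mem_univ i)

theorem NC.mem_extBlocks {n : ℕ} {γ : NC n} {C : Finset (Fin n)} :
    C ∈ γ.extBlocks ↔ C ∈ γ.blocks ∧ ¬ γ.IsInterior C := by
  classical
  simp only [NC.extBlocks, List.mem_map, List.mem_filter, List.mem_finRange, true_and,
    decide_eq_true_eq]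
  constructor
  · rintro ⟨i, ⟨-, h⟩, rfl⟩
    exact ⟨γ.block_mem i, h⟩
  · rintro ⟨hC, h⟩
    have hne := γ.1.nonempty_of_mem_parts hC
    have he : γ.block (C.min' hne) = C := γ.1.part_eq_of_mem hC (C.min'_mem hne)
    exact ⟨C.min' hne, ⟨by rw [he]; exact fun p hp => C.min'_le p hp, by rwa [he]⟩, he⟩

theorem NC.filter_eq_one {n : ℕ} (hn : 0 < n) :
    ∃ γ : NC n, γ.blocks = {Finset.univ} ∧ ∀ γ' : NC n, γ'.blocks = {Finset.univ} → γ' = γ := by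
  have hne : (Finset.univ : Finset (Fin n)) ≠ ⊥ := by
    intro h
    have : (⟨0, hn⟩ : Fin n) ∈ (⊥ : Finset (Fin n)) := h ▸ Finset.mem_univ _
    simp at this
  refine ⟨⟨Finpartition.indiscrete hne, ?_⟩, rfl, ?_⟩
  · intro C hC D hD hCD
    simp only [Finpartition.indiscrete_parts, Finset.mem_singleton] at hC hD
    exact absurd (hC.trans hD.symm) hCD
  · intro γ' h
    apply Subtype.ext
    apply Finpartition.ext
    exact h

/-- The moment-cumulant formula for `φ`. -/
theorem moment_eq_sum_freeCumulant (φ : A →ₗ[ℂ] ℂ) {n : ℕ} (hn : 0 < n) (x : Fin n → A) :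
    φ (List.ofFn x).prod =
      ∑ γ : NC n, ∏ C ∈ γ.blocks, freeCumulant φ C.card (restrict x C) := by
  classical
  obtain ⟨γ₁, h₁, hu⟩ := NC.filter_eq_one hn
  have h := Finset.sum_filter_add_sum_filter_not (Finset.univ : Finset (NC n))
    (fun γ => γ.blocks ≠ {Finset.univ})
    (fun γ => ∏ C ∈ γ.blocks, freeCumulant φ C.card (restrict x C))
  have hs : (Finset.univ.filter fun γ : NC n => ¬ γ.blocks ≠ {Finset.univ}) = {γ₁} := by
    ext γ
    simp only [ne_eq, not_not, Finset.mem_filter, Finset.mem_univ, true_and,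
      Finset.mem_singleton]
    exact ⟨hu γ, fun h => h ▸ h₁⟩
  rw [← h, hs, Finset.sum_singleton, h₁, Finset.prod_singleton,
    restrict_univ_ofFn (freeCumulant φ) x, freeCumulant, add_comm]
  rw [eq_comm, sub_add_eq_add_sub, sub_eq_iff_eq_add]
  congr 1
  refine Finset.sum_congr rfl fun γ hγ => Finset.prod_congr rfl fun C hC => ?_
  rw [dif_pos (NC.card_lt (Finset.mem_filter.1 hγ).2 hC)]

/-- The moment-cumulant formula for `Φ`. -/
theorem moment_eq_sum_cFreeCumulant (Φ : A →ₗ[ℂ] B) (φ : A →ₗ[ℂ] ℂ) {n : ℕ} (hn : 0 < n)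
    (x : Fin n → A) :
    Φ (List.ofFn x).prod =
      ∑ γ : NC n, (∏ D ∈ γ.intBlocks, freeCumulant φ D.card (restrict x D)) •
        (γ.extBlocks.map fun C => cFreeCumulant Φ φ C.card (restrict x C)).prod := by
  classical
  obtain ⟨γ₁, h₁, hu⟩ := NC.filter_eq_one hn
  have h := Finset.sum_filter_add_sum_filter_not (Finset.univ : Finset (NC n))
    (fun γ => γ.blocks ≠ {Finset.univ})
    (fun γ => (∏ D ∈ γ.intBlocks, freeCumulant φ D.card (restrict x D)) •
        (γ.extBlocks.map fun C => cFreeCumulant Φ φ C.card (restrict x C)).prod)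
  have hs : (Finset.univ.filter fun γ : NC n => ¬ γ.blocks ≠ {Finset.univ}) = {γ₁} := by
    ext γ
    simp only [ne_eq, not_not, Finset.mem_filter, Finset.mem_univ, true_and,
      Finset.mem_singleton]
    exact ⟨hu γ, fun h => h ▸ h₁⟩
  have hni : ∀ C ∈ γ₁.blocks, ¬ γ₁.IsInterior C := by
    rintro C hC ⟨D, hD, hne, -⟩
    rw [h₁, Finset.mem_singleton] at hC hD
    exact hne (hD.trans hC.symm)
  have hint : γ₁.intBlocks = ∅ := Finset.filter_eq_empty_iff.2 fun C hC => hni C hC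
  have hblk : ∀ i, γ₁.block i = Finset.univ := by
    intro i
    have := γ₁.block_mem i
    rwa [h₁, Finset.mem_singleton] at this
  have hext : γ₁.extBlocks = [Finset.univ] := by
    have hfil : ((List.finRange n).filter fun i =>
        (∀ p ∈ γ₁.block i, i ≤ p) ∧ ¬ γ₁.IsInterior (γ₁.block i)) = [⟨0, hn⟩] := by
      obtain ⟨m, rfl⟩ : ∃ m, n = m + 1 := ⟨n - 1, by omega⟩
      rw [List.finRange_succ, List.filter_cons_of_pos]
      · congr 1
        rw [List.filter_eq_nil_iff]
        intro i hi
        obtain ⟨j, -, rfl⟩ := List.mem_map.1 hi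
        simp only [hblk, decide_eq_true_eq, not_and]
        intro h0
        exact absurd (h0 0 (Finset.mem_univ _)) (by simp)
      · simp only [decide_eq_true_eq]
        exact ⟨fun p _ => Fin.zero_le p, hni _ (γ₁.block_mem _)⟩
    simp only [NC.extBlocks]
    rw [hfil]
    simp [hblk]
  rw [← h, hs, Finset.sum_singleton, hint, hext, Finset.prod_empty, one_smul,
    List.map_singleton, List.prod_singleton,
    restrict_univ_ofFn (cFreeCumulant Φ φ) x, cFreeCumulant, add_comm]
  rw [eq_comm, sub_add_eq_add_sub, sub_eq_iff_eq_add]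
  congr 1
  refine Finset.sum_congr rfl fun γ hγ => ?_
  congr 2
  refine List.map_congr_left fun C hC => ?_
  rw [dif_pos (NC.card_lt (Finset.mem_filter.1 hγ).2 (NC.mem_extBlocks.1 hC).1)]

/-! ### c-freeness -/

/-- The unital subalgebras `A₁`, `A₂` are c-free with respect to `(Φ, φ)`: for every alternating
tuple `a_1, …, a_n` (`n ≥ 1`) of `φ`-centred elements of `A₁` and `A₂`,
`φ(a_1 ⋯ a_n) = 0` and `Φ(a_1 ⋯ a_n) = Φ(a_1) ⋯ Φ(a_n)`. -/
def SubalgebrasCFree (Φ : A →ₗ[ℂ] B) (φ : A →ₗ[ℂ] ℂ) (A₁ A₂ : Subalgebra ℂ A) : Prop :=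
  ∀ (n : ℕ), 0 < n → ∀ (ε : Fin n → Fin 2) (a : Fin n → A),
    (∀ j, φ (a j) = 0) →
    (∀ j, a j ∈ (![A₁, A₂] : Fin 2 → Subalgebra ℂ A) (ε j)) →
    (∀ (j : ℕ) (h : j + 1 < n), ε ⟨j, by omega⟩ ≠ ε ⟨j + 1, h⟩) →
      φ (List.ofFn a).prod = 0 ∧
      Φ (List.ofFn a).prod = (List.ofFn fun j => Φ (a j)).prod

/-- Two elements are c-free if the unital subalgebras that they generate are c-free. -/
def ElementsCFree (Φ : A →ₗ[ℂ] B) (φ : A →ₗ[ℂ] ℂ) (X Y : A) : Prop :=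
  SubalgebrasCFree Φ φ (Algebra.adjoin ℂ {X}) (Algebra.adjoin ℂ {Y})

/-- `κ_n(X) = κ_n(X, …, X)`. -/
def freeCumulantOne (φ : A →ₗ[ℂ] ℂ) (n : ℕ) (X : A) : ℂ := freeCumulant φ n fun _ => X

/-- `ᶜκ_n(X) = ᶜκ_n(X, …, X)`. -/
def cFreeCumulantOne (Φ : A →ₗ[ℂ] B) (φ : A →ₗ[ℂ] ℂ) (n : ℕ) (X : A) : B :=
  cFreeCumulant Φ φ n fun _ => X

end Cumulants

end CFree

end

/-!
Both formulas are read off from generating functions, in a variable written `t` here (it is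
`PowerSeries.X` below).

*Combinatorial side.* Cutting a non-crossing partition of `n + 1` points at the second element of
the block of the first point gives a bijection with pairs of non-crossing partitions of `m` and
`k` points, `m + k = n` (`NC.join`, `sum_NC_succ`), and the Kreweras complement follows the
mirrored cut (`krewerasRel_joinRel`). Let the size of the first or last block be counted with an
arbitrary excess; the decomposition then relates each family of series to itself with the excess
raised by one, and `eq_sub_mul` solves such a recursion by a substitution. Two identities result.
The moment series `m` (scalar) and `m'` (with values in `B`) of an element satisfy, with the
cumulant series `c = ∑ κₙ₊₁ tⁿ` and `d = ∑ ᶜκₙ₊₁ tⁿ`,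
`m' = 1 + t d(t m) m'` (`shift_outerMomentSeries`), and the same with `c` and `m` in place of `d`
and `m'`. On the other hand the right-hand sides of the two product formulas are the coefficients
of `c_X(v) c_Y(u)` and of `d_X(v) d_Y(u)`, where `u = t c_X(v)` and `v = t c_Y(u)`
(`krewerasSum_scalar_eq`, `krewerasSum_eq`).

*Algebraic side.* Put `N = 1 + t c_X(v) c_Y(u)`, `x = v / N`, `y = u / N` and `z = t / N`. The
functional equation shows that the resolvents `R = (1 - x X)⁻¹` and `S = (1 - y Y)⁻¹` both have
the scalar moment series `N`, so that `R = N + v p` and `S = N + u q` with centred series `p`, `q`,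
and one checks (`one_sub_mul_factorization`)
`(1 - x X) (1 - z p q) (1 - y Y) = N⁻¹ (1 - z X Y)`.
Hence `(1 - z X Y)⁻¹ = N⁻¹ S (1 - z p q)⁻¹ R` is a combination of alternating products of centred
elements, and c-freeness computes its images under `φ` and `Φ`
(`CFreeFamily.mapLin_alternating`). The image under `φ` is `N`. The image under `Φ` is found by
applying the same factorization in `B⟦t⟧` to `d_X(v)` and `d_Y(u)` in place of `X` and `Y`; it is
`(1 - z d_X(v) d_Y(u))⁻¹`. Comparison with the functional equations of the moment series of `X Y`
at `z`, where `z N = t`, identifies the cumulant series of `X Y` (`cumulantSeries_mul`).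
No division by a moment occurs, so that elements of mean zero need no separate treatment.
-/

noncomputable section

namespace CFree

open PowerSeries

/-! ### Substitution into power series with non-commutative coefficients -/

section Shift

variable {B : Type*} [Ring B]

/-- The series `∑ₙ Fₙ₊₁ Xⁿ`. -/
def shift (F : B⟦X⟧) : B⟦X⟧ := PowerSeries.mk fun n => coeff (n + 1) F

@[simp] theorem coeff_shift (F : B⟦X⟧) (n : ℕ) : coeff n (shift F) = coeff (n + 1) F := by
  simp [shift]

theorem eq_C_add_X_mul_shift (F : B⟦X⟧) : F = C (coeff 0 F) + X * shift F := by
  ext n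
  cases n with
  | zero => simp
  | succ n => rw [map_add, coeff_succ_X_mul]; simp

end Shift

section Substitution

variable {A B : Type*} [Ring A] [Algebra ℂ A] [Ring B] [Algebra ℂ B]

/-- The embedding of the scalar power series as central elements of `B⟦X⟧`. -/
def scal (B : Type*) [Ring B] [Algebra ℂ B] : ℂ⟦X⟧ →+* B⟦X⟧ := PowerSeries.map (algebraMap ℂ B)

theorem scal_commute (f : ℂ⟦X⟧) (F : B⟦X⟧) : scal B f * F = F * scal B f := by
  ext n
  rw [coeff_mul, coeff_mul, ← Finset.Nat.sum_antidiagonal_swap]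
  refine Finset.sum_congr rfl fun p _ => ?_
  simp only [scal, coeff_map, Prod.fst_swap, Prod.snd_swap]
  exact Algebra.commutes _ _

theorem coeff_scal_mul (f : ℂ⟦X⟧) (F : B⟦X⟧) (n : ℕ) :
    coeff n (scal B f * F) =
      ∑ p ∈ Finset.HasAntidiagonal.antidiagonal n, coeff p.1 f • coeff p.2 F := by
  rw [coeff_mul]
  refine Finset.sum_congr rfl fun p _ => ?_
  simp [scal, Algebra.smul_def]

@[simp] theorem scal_X : scal B X = X := by simp [scal]

@[simp] theorem scal_self (f : ℂ⟦X⟧) : scal ℂ f = f := by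
  ext n; simp [scal]

/-- If `g` has no constant term then each factor `g` raises the order, so that the coefficient
of index `n` of `g * F` only depends on the coefficients of index `< n` of `F`. -/
theorem coeff_scal_mul_mem {S : Submodule ℂ B} {g : ℂ⟦X⟧} (hg : constantCoeff g = 0)
    {F : B⟦X⟧} {n : ℕ} (h : ∀ k < n, coeff k F ∈ S) : coeff n (scal B g * F) ∈ S := by
  rw [coeff_scal_mul]
  refine Submodule.sum_mem _ fun p hp => ?_
  rw [Finset.HasAntidiagonal.mem_antidiagonal] at hp
  rcases Nat.eq_zero_or_pos p.1 with h0 | h0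
  · rw [h0, coeff_zero_eq_constantCoeff_apply, hg, zero_smul]
    exact S.zero_mem
  · exact S.smul_mem _ (h _ (by omega))

/-- A family with `D s = g * D (s + 1)` vanishes, since each `D s` is divisible by all powers
of `g`. -/
theorem eq_zero_of_forall_eq_mul_succ {g : ℂ⟦X⟧} (hg : constantCoeff g = 0) {D : ℕ → B⟦X⟧}
    (h : ∀ s, D s = scal B g * D (s + 1)) (s : ℕ) : D s = 0 := by
  have key : ∀ n s, coeff n (D s) = 0 := by
    intro n
    induction n using Nat.strong_induction_on with
    | _ n ih =>
      intro s
      rw [h s]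
      have := coeff_scal_mul_mem (S := (⊥ : Submodule ℂ B)) hg (F := D (s + 1)) (n := n)
        (fun k hk => (Submodule.mem_bot ℂ).2 (ih k hk _))
      exact (Submodule.mem_bot ℂ).1 this
  ext n
  simp [key]

/-- `sub g F = ∑ₖ Fₖ gᵏ`, the substitution of a scalar series `g` without constant term into a
power series `F` with coefficients in `B`. For a series `g` with a constant term the value is
meaningless. -/
def sub (g : ℂ⟦X⟧) (F : B⟦X⟧) : B⟦X⟧ :=
  PowerSeries.mk fun n => ∑ k ∈ Finset.range (n + 1), coeff n (g ^ k) • coeff k F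

theorem coeff_pow_eq_zero {g : ℂ⟦X⟧} (hg : constantCoeff g = 0) {n k : ℕ} (h : n < k) :
    coeff n (g ^ k) = 0 := by
  have : X ^ k ∣ g ^ k := pow_dvd_pow_of_dvd (X_dvd_iff.2 hg) k
  exact X_pow_dvd_iff.1 this n h

theorem coeff_sub {g : ℂ⟦X⟧} (hg : constantCoeff g = 0) (F : B⟦X⟧) {n N : ℕ} (h : n < N) :
    coeff n (sub g F) = ∑ k ∈ Finset.range N, coeff n (g ^ k) • coeff k F := by
  rw [sub, coeff_mk]
  refine Finset.sum_subset (Finset.range_subset_range.2 h) fun k _ hk => ?_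
  rw [coeff_pow_eq_zero hg (by simpa using hk), zero_smul]

theorem sub_eq {g : ℂ⟦X⟧} (hg : constantCoeff g = 0) (F : B⟦X⟧) :
    sub g F = C (coeff 0 F) + scal B g * sub g (shift F) := by
  ext n
  rw [coeff_sub hg F (show n < n + 1 + 1 by omega), Finset.sum_range_succ', map_add,
    coeff_scal_mul, add_comm]
  congr 1
  · simp only [pow_zero, coeff_one, coeff_C]
    split_ifs <;> simp
  · have : ∀ p ∈ Finset.HasAntidiagonal.antidiagonal n, coeff p.1 g • coeff p.2 (sub g (shift F)) =
        ∑ k ∈ Finset.range (n + 1), (coeff p.1 g * coeff p.2 (g ^ k)) • coeff (k + 1) F := by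
      intro p hp
      rw [Finset.HasAntidiagonal.mem_antidiagonal] at hp
      rw [coeff_sub hg _ (show p.2 < n + 1 by omega), Finset.smul_sum]
      exact Finset.sum_congr rfl fun k _ => by rw [coeff_shift, smul_smul]
    rw [Finset.sum_congr rfl this, Finset.sum_comm]
    refine Finset.sum_congr rfl fun k _ => ?_
    rw [← Finset.sum_smul, pow_succ', coeff_mul]

/-- The substitution is pinned down by the recursion that splits off the constant term. All
functional equations below are obtained in this way, from families of series in which the weight
of a distinguished block is shifted. -/
theorem eq_sub_mul {g : ℂ⟦X⟧} (hg : constantCoeff g = 0) {F : ℕ → B⟦X⟧} {b : ℕ → B} {Z : B⟦X⟧}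
    (h : ∀ s, F s = C (b s) * Z + scal B g * F (s + 1)) : F 0 = sub g (PowerSeries.mk b) * Z := by
  have := eq_zero_of_forall_eq_mul_succ hg
    (D := fun s => F s - sub g (PowerSeries.mk fun n => b (n + s)) * Z) ?_ 0
  · simpa [sub_eq_zero] using this
  · intro s
    have e : shift (PowerSeries.mk fun n => b (n + s)) =
        PowerSeries.mk fun n => b (n + (s + 1)) := by
      ext n; simp [add_right_comm, add_assoc]
    rw [h s, sub_eq hg, e]
    simp only [coeff_mk, zero_add]
    noncomm_ring

theorem sub_add (g : ℂ⟦X⟧) (F G : B⟦X⟧) : sub g (F + G) = sub g F + sub g G := by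
  ext n; simp [sub, Finset.sum_add_distrib]

theorem sub_C {g : ℂ⟦X⟧} (hg : constantCoeff g = 0) (a : B) : sub g (C a) = C a := by
  rw [sub_eq hg]
  have : shift (C a) = (0 : B⟦X⟧) := by ext n; simp
  have h0 : sub g (0 : B⟦X⟧) = 0 := by ext n; simp [sub]
  simp [this, h0]

theorem sub_X_mul {g : ℂ⟦X⟧} (hg : constantCoeff g = 0) (F : B⟦X⟧) :
    sub g (X * F) = scal B g * sub g F := by
  rw [sub_eq hg]
  have : shift (X * F) = F := by ext n; rw [coeff_shift, coeff_succ_X_mul]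
  simp [this]

theorem sub_X {g : ℂ⟦X⟧} (hg : constantCoeff g = 0) : sub g (X : B⟦X⟧) = scal B g := by
  have h := sub_X_mul hg (C (1 : B))
  rw [sub_C hg] at h
  simpa using h

theorem sub_mul {g : ℂ⟦X⟧} (hg : constantCoeff g = 0) (F G : B⟦X⟧) :
    sub g (F * G) = sub g F * sub g G := by
  have := eq_sub_mul hg (F := fun s => sub g ((PowerSeries.mk fun n => coeff (n + s) F) * G))
    (b := fun s => coeff s F) (Z := sub g G) ?_
  · have e : (PowerSeries.mk fun n => coeff n F) = F := by ext n; simp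
    simpa [e] using this
  · intro s
    have hG : C (coeff s F) * sub g G = sub g (C (coeff s F) * G) := by
      ext n
      simp only [coeff_C_mul, sub, coeff_mk, Finset.mul_sum, mul_smul_comm]
    rw [hG, ← sub_X_mul hg, ← sub_add]
    congr 1
    conv_lhs => rw [eq_C_add_X_mul_shift (PowerSeries.mk fun n => coeff (n + s) F)]
    have e : shift (PowerSeries.mk fun n => coeff (n + s) F) =
        PowerSeries.mk fun n => coeff (n + (s + 1)) F := by
      ext n; simp [add_right_comm, add_assoc]
    rw [e]
    simp [add_mul, mul_assoc]

theorem scal_sub (g f : ℂ⟦X⟧) : scal B (sub g f) = sub g (scal B f) := by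
  ext n
  simp [scal, sub, Algebra.smul_def]

theorem constantCoeff_sub {g f : ℂ⟦X⟧} (hg : constantCoeff g = 0) (hf : constantCoeff f = 0) :
    constantCoeff (sub g f) = 0 := by
  rw [sub_eq hg]
  simp [hg, hf]

theorem sub_sub_eq {g f : ℂ⟦X⟧} (hg : constantCoeff g = 0) (hf : constantCoeff f = 0) (F : B⟦X⟧) :
    sub g (sub f F) = sub (sub g f) F := by
  have := eq_sub_mul (constantCoeff_sub hg hf)
    (F := fun s => sub g (sub f (PowerSeries.mk fun n => coeff (n + s) F)))
    (b := fun s => coeff s F) (Z := 1) ?_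
  · have e : (PowerSeries.mk fun n => coeff n F) = F := by ext n; simp
    simpa [e] using this
  · intro s
    have e : shift (PowerSeries.mk fun n => coeff (n + s) F) =
        PowerSeries.mk fun n => coeff (n + (s + 1)) F := by
      ext n; simp [add_right_comm, add_assoc]
    rw [sub_eq hf, e, sub_add, sub_C hg, sub_mul hg, scal_sub]
    simp

theorem coeff_sub_congr {f g : ℂ⟦X⟧} {N : ℕ} (h : X ^ N ∣ f - g) (F : B⟦X⟧) {n : ℕ} (hn : n < N) :
    coeff n (sub f F) = coeff n (sub g F) := by
  simp only [sub, coeff_mk]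
  refine Finset.sum_congr rfl fun k _ => ?_
  have := X_pow_dvd_iff.1 (h.trans (sub_dvd_pow_sub_pow f g k)) n hn
  rw [map_sub, sub_eq_zero] at this
  rw [this]

/-- The equation `f = 1 + x f c(x f)` has at most one solution. -/
theorem eq_of_functional_equation {x f g c : ℂ⟦X⟧} (hx : constantCoeff x = 0)
    (hf : f = 1 + x * f * sub (x * f) c) (hg : g = 1 + x * g * sub (x * g) c) : f = g := by
  -- a factor `x` is gained whenever the equation is used
  have key : ∀ N, X ^ N ∣ f - g := by
    intro N
    induction N with
    | zero => simp
    | succ N ih =>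
      obtain ⟨y, rfl⟩ := X_dvd_iff.2 hx
      have h1 : X ^ N ∣ f * sub (X * y * f) c - g * sub (X * y * g) c := by
        have h2 : X ^ N ∣ sub (X * y * f) c - sub (X * y * g) c := by
          rw [X_pow_dvd_iff]
          intro m hm
          rw [map_sub, sub_eq_zero]
          refine coeff_sub_congr ?_ c hm
          rw [← mul_sub]
          exact ih.mul_left _
        have : f * sub (X * y * f) c - g * sub (X * y * g) c =
          (f - g) * sub (X * y * f) c + g * (sub (X * y * f) c - sub (X * y * g) c) := by ring
        rw [this]
        exact dvd_add (ih.mul_right _) (h2.mul_left _)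
      have : f - g = X * (y * (f * sub (X * y * f) c - g * sub (X * y * g) c)) := by
        linear_combination hf - hg
      rw [this, pow_succ']
      exact mul_dvd_mul_left _ (h1.mul_left _)
  rw [← sub_eq_zero]
  ext n
  simpa using X_pow_dvd_iff.1 (key (n + 1)) n (Nat.lt_succ_self n)

/-- The coefficientwise extension of a linear map to power series. -/
def mapLin (Φ : A →ₗ[ℂ] B) (F : A⟦X⟧) : B⟦X⟧ := PowerSeries.mk fun n => Φ (coeff n F)

@[simp] theorem coeff_mapLin (Φ : A →ₗ[ℂ] B) (F : A⟦X⟧) (n : ℕ) :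
    coeff n (mapLin Φ F) = Φ (coeff n F) := by simp [mapLin]

theorem mapLin_add (Φ : A →ₗ[ℂ] B) (F G : A⟦X⟧) :
    mapLin Φ (F + G) = mapLin Φ F + mapLin Φ G := by ext n; simp

theorem mapLin_sub (Φ : A →ₗ[ℂ] B) (F G : A⟦X⟧) :
    mapLin Φ (F - G) = mapLin Φ F - mapLin Φ G := by ext n; simp

theorem mapLin_scal_mul (Φ : A →ₗ[ℂ] B) (f : ℂ⟦X⟧) (F : A⟦X⟧) :
    mapLin Φ (scal A f * F) = scal B f * mapLin Φ F := by
  ext n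
  simp [coeff_scal_mul]

theorem mapLin_scal {Φ : A →ₗ[ℂ] B} (hΦ : Φ 1 = 1) (f : ℂ⟦X⟧) :
    mapLin Φ (scal A f) = scal B f := by
  ext n
  simp [scal, Algebra.algebraMap_eq_smul_one, hΦ]

theorem mapLin_subst (Φ : A →ₗ[ℂ] B) (g : ℂ⟦X⟧) (F : A⟦X⟧) :
    mapLin Φ (sub g F) = sub g (mapLin Φ F) := by
  ext n
  simp [sub]

end Substitution

/-! ### Non-crossing partitions as relations on the natural numbers -/

section Relations

/-- The relation on `ℕ` underlying a non-crossing partition: both arguments are positions `< n`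
and lie in the same block. -/
def NC.Rel {n : ℕ} (γ : NC n) (a b : ℕ) : Prop :=
  ∃ (ha : a < n) (hb : b < n), (⟨b, hb⟩ : Fin n) ∈ γ.block ⟨a, ha⟩

/-- A relation on `ℕ` is the relation of a non-crossing partition of `{0, …, n - 1}`. -/
structure IsNCRel (n : ℕ) (r : ℕ → ℕ → Prop) : Prop where
  refl : ∀ a < n, r a a
  lt : ∀ a b, r a b → a < n
  symm : ∀ a b, r a b → r b a
  trans : ∀ a b c, r a b → r b c → r a c
  nc : ∀ a b c d, a < b → b < c → c < d → r a c → r b d → r a b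

theorem NC.mem_block {n : ℕ} {γ : NC n} {i j : Fin n} :
    j ∈ γ.block i ↔ γ.block j = γ.block i := by
  rw [NC.block, NC.block, γ.1.mem_part_iff_part_eq_part (Finset.mem_univ _) (Finset.mem_univ _)]

theorem NC.block_eq_of_mem {n : ℕ} {γ : NC n} {C : Finset (Fin n)} (hC : C ∈ γ.blocks) {i : Fin n}
    (hi : i ∈ C) : γ.block i = C := γ.1.part_eq_of_mem hC hi

theorem NC.rel_iff {n : ℕ} {γ : NC n} {i j : Fin n} :
    γ.Rel i j ↔ γ.block i = γ.block j := by
  simp [NC.Rel, NC.mem_block, eq_comm]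

theorem NC.isNCRel {n : ℕ} (γ : NC n) : IsNCRel n γ.Rel := by
  refine ⟨fun a ha => ⟨ha, ha, NC.mem_block.2 rfl⟩, fun a b h => h.1, ?_, ?_, ?_⟩
  · rintro a b ⟨ha, hb, h⟩
    exact ⟨hb, ha, NC.mem_block.2 (NC.mem_block.1 h).symm⟩
  · rintro a b c ⟨ha, hb, h⟩ ⟨_, hc, h'⟩
    exact ⟨ha, hc, NC.mem_block.2 ((NC.mem_block.1 h').trans (NC.mem_block.1 h))⟩
  · rintro a b c d hab hbc hcd ⟨ha, hc, h⟩ ⟨hb, hd, h'⟩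
    by_contra hne
    have hne' : γ.block ⟨a, ha⟩ ≠ γ.block ⟨b, hb⟩ := fun e => hne ⟨ha, hb, NC.mem_block.2 e.symm⟩
    exact γ.2 _ (γ.block_mem ⟨a, ha⟩) _ (γ.block_mem ⟨b, hb⟩) hne' ⟨a, ha⟩ ⟨b, hb⟩ ⟨c, hc⟩ ⟨d, hd⟩
      hab hbc hcd ⟨NC.mem_block.2 rfl, h, NC.mem_block.2 rfl, h'⟩

theorem NC.rel_injective {n : ℕ} {γ γ' : NC n} (h : γ.Rel = γ'.Rel) : γ = γ' := by
  have hb : ∀ i, γ.block i = γ'.block i := by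
    intro i
    ext j
    have := congrFun (congrFun h i) j
    simpa [NC.Rel] using this
  apply Subtype.ext
  apply Finpartition.ext
  ext C
  constructor
  · intro hC
    obtain ⟨i, hi⟩ := γ.1.nonempty_of_mem_parts hC
    rw [← NC.block_eq_of_mem (γ := γ) hC hi, hb]
    exact γ'.block_mem i
  · intro hC
    obtain ⟨i, hi⟩ := γ'.1.nonempty_of_mem_parts hC
    rw [← NC.block_eq_of_mem (γ := γ') hC hi, ← hb]
    exact γ.block_mem i

theorem IsNCRel.exists_nc {n : ℕ} {r : ℕ → ℕ → Prop} (h : IsNCRel n r) :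
    ∃ γ : NC n, γ.Rel = r := by
  classical
  let s : Setoid (Fin n) :=
    { r := fun i j => r i j
      iseqv := ⟨fun i => h.refl i i.2, fun {i j} hij => h.symm i j hij,
        fun {i j k} hij hjk => h.trans i j k hij hjk⟩ }
  have hs : ∀ i j, s i j ↔ r i j := fun i j => Iff.rfl
  have hsame : ∀ C ∈ (Finpartition.ofSetoid s).parts, ∀ i ∈ C, ∀ j ∈ C, s i j := by
    intro C hC i hi j hj
    rw [← (Finpartition.ofSetoid s).part_eq_of_mem hC hi,
      Finpartition.mem_part_ofSetoid_iff_rel] at hj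
    exact hj
  refine ⟨⟨Finpartition.ofSetoid s, ?_⟩, ?_⟩
  · rintro C hC D hD hne i k p q hik hkp hpq ⟨hi, hp, hk, hq⟩
    have h3 : s i k := h.nc i k p q hik hkp hpq (hsame C hC i hi p hp) (hsame D hD k hk q hq)
    have : k ∈ C := by
      rw [← (Finpartition.ofSetoid s).part_eq_of_mem hC hi,
        Finpartition.mem_part_ofSetoid_iff_rel]
      exact h3
    exact hne ((Finpartition.ofSetoid s).eq_of_mem_parts hC hD this hk)
  · funext a b
    refine propext ⟨?_, fun hab => ⟨h.lt _ _ hab, h.lt _ _ (h.symm _ _ hab), ?_⟩⟩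
    · rintro ⟨ha, hb, hab⟩
      exact Finpartition.mem_part_ofSetoid_iff_rel.1 hab
    · exact Finpartition.mem_part_ofSetoid_iff_rel.2 hab

/-- The non-crossing partition with a given underlying relation. -/
def NC.ofRel {n : ℕ} {r : ℕ → ℕ → Prop} (h : IsNCRel n r) : NC n := h.exists_nc.choose

@[simp] theorem NC.rel_ofRel {n : ℕ} {r : ℕ → ℕ → Prop} (h : IsNCRel n r) :
    (NC.ofRel h).Rel = r := h.exists_nc.choose_spec

open Classical in
/-- The size of the block of `a`; it is `0` when `a` is not a position. -/
def relSize (n : ℕ) (r : ℕ → ℕ → Prop) (a : ℕ) : ℕ := ∑ b ∈ Finset.range n, if r a b then 1 else 0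

/-- `a` is the first element of its block. -/
def IsBlockMin (r : ℕ → ℕ → Prop) (a : ℕ) : Prop := ∀ b, r a b → a ≤ b

/-- `a` is the last element of its block. -/
def IsBlockMax (r : ℕ → ℕ → Prop) (a : ℕ) : Prop := ∀ b, r a b → b ≤ a

/-- The block of `a` is interior, because `a` lies under an arc of another block. -/
def IsInner (r : ℕ → ℕ → Prop) (a : ℕ) : Prop := ∃ i j, i < a ∧ a < j ∧ r i j ∧ ¬ r i a

open Classical in
/-- The product of the weights `f |C|` over the blocks `C` represented by a position
with property `p`. -/
def relProd (n : ℕ) (r : ℕ → ℕ → Prop) (p : ℕ → Prop) (f : ℕ → ℂ) : ℂ :=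
  ∏ a ∈ Finset.range n, if p a then f (relSize n r a) else 1

open Classical in
/-- The product, in increasing order of the representatives, of the weights `g |C|` over the
blocks `C` represented by a position with property `p`. -/
def relListProd {B : Type*} [Ring B] (n : ℕ) (r : ℕ → ℕ → Prop) (p : ℕ → Prop) (g : ℕ → B) : B :=
  ((List.range n).map fun a => if p a then g (relSize n r a) else 1).prod

theorem NC.card_block {n : ℕ} (γ : NC n) (i : Fin n) :
    (γ.block i).card = relSize n γ.Rel i := by
  classical
  rw [relSize, ← Fin.sum_univ_eq_sum_range (fun b => if γ.Rel i b then 1 else 0), Finset.sum_boole,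
    Nat.cast_id]
  congr 1
  ext j
  simp [NC.Rel]

/-- A product over a set `Q` of blocks is a product over any system of representatives. -/
theorem NC.prod_eq_relProd {n : ℕ} (γ : NC n) (Q : Finset (Finset (Fin n))) (p : ℕ → Prop)
    (f : ℕ → ℂ) (hQ : ∀ i : Fin n, p i → γ.block i ∈ Q)
    (hp : ∀ C ∈ Q, ∃ i : Fin n, p i ∧ γ.block i = C)
    (hinj : ∀ a b, γ.Rel a b → p a → p b → a = b) :
    ∏ C ∈ Q, f C.card = relProd n γ.Rel p f := by
  classical
  rw [relProd, ← Fin.prod_univ_eq_prod_range (fun a => if p a then f (relSize n γ.Rel a) else 1),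
    ← Finset.prod_filter]
  symm
  refine Finset.prod_nbij γ.block ?_ ?_ ?_ ?_
  · intro i hi
    exact hQ i (by simpa using hi)
  · intro i hi j hj hij
    exact Fin.ext (hinj i j (NC.rel_iff.2 hij) (by simpa using hi) (by simpa using hj))
  · intro C hC
    obtain ⟨i, hi, rfl⟩ := hp C hC
    exact ⟨i, by simpa using hi, rfl⟩
  · intro i _
    rw [NC.card_block]

theorem IsNCRel.eq_of_isBlockMin {n : ℕ} {r : ℕ → ℕ → Prop} (h : IsNCRel n r) {a b : ℕ}
    (hab : r a b) (ha : IsBlockMin r a) (hb : IsBlockMin r b) : a = b :=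
  le_antisymm (ha b hab) (hb a (h.symm _ _ hab))

theorem IsNCRel.eq_of_isBlockMax {n : ℕ} {r : ℕ → ℕ → Prop} (h : IsNCRel n r) {a b : ℕ}
    (hab : r a b) (ha : IsBlockMax r a) (hb : IsBlockMax r b) : a = b :=
  le_antisymm (hb a (h.symm _ _ hab)) (ha b hab)

theorem NC.exists_isBlockMin {n : ℕ} (γ : NC n) {C : Finset (Fin n)} (hC : C ∈ γ.blocks) :
    ∃ i : Fin n, IsBlockMin γ.Rel i ∧ γ.block i = C := by
  have hne := γ.1.nonempty_of_mem_parts hC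
  have he := NC.block_eq_of_mem hC (C.min'_mem hne)
  refine ⟨C.min' hne, ?_, he⟩
  rintro b ⟨h1, h2, hb⟩
  change _ ∈ γ.block (C.min' hne) at hb
  rw [he] at hb
  exact C.min'_le _ hb

theorem NC.exists_isBlockMax {n : ℕ} (γ : NC n) {C : Finset (Fin n)} (hC : C ∈ γ.blocks) :
    ∃ i : Fin n, IsBlockMax γ.Rel i ∧ γ.block i = C := by
  have hne := γ.1.nonempty_of_mem_parts hC
  have he := NC.block_eq_of_mem hC (C.max'_mem hne)
  refine ⟨C.max' hne, ?_, he⟩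
  rintro b ⟨h1, h2, hb⟩
  change _ ∈ γ.block (C.max' hne) at hb
  rw [he] at hb
  exact C.le_max' _ hb

/-- Since no two blocks cross, one element of a block lying under an arc of another block is enough
for the whole block to lie under it. -/
theorem NC.isInterior_block_iff {n : ℕ} (γ : NC n) (i : Fin n) :
    γ.IsInterior (γ.block i) ↔ IsInner γ.Rel i := by
  constructor
  · rintro ⟨D, hD, hne, j, hj, k, hk, h⟩
    obtain ⟨h1, h2⟩ := h i (NC.mem_block.2 rfl)
    have ej := NC.block_eq_of_mem hD hj
    have ek := NC.block_eq_of_mem hD hk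
    refine ⟨j, k, h1, h2, NC.rel_iff.2 (ej.trans ek.symm), fun h => hne ?_⟩
    rw [← ej, NC.rel_iff.1 h]
  · rintro ⟨a, b, h1, h2, hab, hai⟩
    have hr := γ.isNCRel
    obtain ⟨ha, hb, hab'⟩ := id hab
    refine ⟨γ.block ⟨a, ha⟩, γ.block_mem _, fun e => hai ?_, ⟨a, ha⟩, NC.mem_block.2 rfl,
      ⟨b, hb⟩, hab', ?_⟩
    · exact NC.rel_iff.2 e
    · intro p hp
      have hip : γ.Rel i p := NC.rel_iff.2 (NC.mem_block.1 hp).symm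
      have hap : ¬ γ.Rel a p := fun h => hai (hr.trans _ _ _ h (hr.symm _ _ hip))
      have hpa : a ≠ p := by rintro rfl; exact hai (hr.symm _ _ hip)
      have hpb : b ≠ p := by rintro rfl; exact hap hab
      rw [Fin.lt_def, Fin.lt_def]
      constructor
      · by_contra hlt
        exact hai (hr.symm _ _ (hr.trans _ _ _ hip
          (hr.nc p a i b (by simp at hlt; omega) h1 h2 (hr.symm _ _ hip) hab)))
      · by_contra hlt
        exact hai (hr.nc a i b p h1 h2 (by simp at hlt; omega) hab hip)

theorem NC.prod_blocks_min {n : ℕ} (γ : NC n) (f : ℕ → ℂ) :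
    ∏ C ∈ γ.blocks, f C.card = relProd n γ.Rel (IsBlockMin γ.Rel) f :=
  γ.prod_eq_relProd _ _ f (fun i _ => γ.block_mem i) (fun _ hC => γ.exists_isBlockMin hC)
    fun _ _ => γ.isNCRel.eq_of_isBlockMin

theorem NC.prod_blocks_erase_first {n : ℕ} (γ : NC n) (hn : 0 < n) (f : ℕ → ℂ) :
    ∏ C ∈ γ.blocks.erase (γ.block ⟨0, hn⟩), f C.card =
      relProd n γ.Rel (fun a => IsBlockMin γ.Rel a ∧ a ≠ 0) f := by
  refine γ.prod_eq_relProd _ _ f (fun i hi => Finset.mem_erase.2 ⟨fun e => hi.2 ?_, γ.block_mem i⟩)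
    (fun C hC => ?_) fun _ _ h h1 h2 => γ.isNCRel.eq_of_isBlockMin h h1.1 h2.1
  · have := hi.1 0 ((NC.rel_iff (i := i) (j := ⟨0, hn⟩)).2 e)
    omega
  · rw [Finset.mem_erase] at hC
    obtain ⟨i, hi, rfl⟩ := γ.exists_isBlockMin hC.2
    exact ⟨i, ⟨hi, fun h => hC.1 (by congr 1; exact Fin.ext h)⟩, rfl⟩

theorem NC.prod_blocks_erase_last {n : ℕ} (γ : NC n) (hn : n - 1 < n) (f : ℕ → ℂ) :
    ∏ C ∈ γ.blocks.erase (γ.block ⟨n - 1, hn⟩), f C.card =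
      relProd n γ.Rel (fun a => IsBlockMax γ.Rel a ∧ a + 1 ≠ n) f := by
  refine γ.prod_eq_relProd _ _ f (fun i hi => Finset.mem_erase.2 ⟨fun e => hi.2 ?_, γ.block_mem i⟩)
    (fun C hC => ?_) fun _ _ h h1 h2 => γ.isNCRel.eq_of_isBlockMax h h1.1 h2.1
  · have := hi.1 (n - 1) ((NC.rel_iff (i := i) (j := ⟨n - 1, hn⟩)).2 e)
    omega
  · rw [Finset.mem_erase] at hC
    obtain ⟨i, hi, rfl⟩ := γ.exists_isBlockMax hC.2
    refine ⟨i, ⟨hi, fun h => hC.1 ?_⟩, rfl⟩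
    congr 1
    apply Fin.ext
    simp only
    omega

theorem NC.prod_intBlocks {n : ℕ} (γ : NC n) (f : ℕ → ℂ) :
    ∏ C ∈ γ.intBlocks, f C.card =
      relProd n γ.Rel (fun a => IsBlockMin γ.Rel a ∧ IsInner γ.Rel a) f := by
  classical
  refine γ.prod_eq_relProd _ _ f (fun i hi => ?_)
    (fun C hC => ?_) fun _ _ h h1 h2 => γ.isNCRel.eq_of_isBlockMin h h1.1 h2.1
  · exact Finset.mem_filter.2 ⟨γ.block_mem i, (γ.isInterior_block_iff i).2 hi.2⟩
  · rw [NC.intBlocks, Finset.mem_filter] at hC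
    obtain ⟨i, hi, rfl⟩ := γ.exists_isBlockMin hC.1
    exact ⟨i, ⟨hi, (γ.isInterior_block_iff i).1 hC.2⟩, rfl⟩

theorem prod_map_filter {α M : Type*} [Monoid M] (l : List α) (p : α → Prop) [DecidablePred p]
    (f : α → M) : ((l.filter p).map f).prod = (l.map fun a => if p a then f a else 1).prod := by
  induction l with
  | nil => rfl
  | cons a l ih =>
    by_cases h : p a <;> simp [h, ih]

theorem NC.prod_extBlocks {B : Type*} [Ring B] {n : ℕ} (γ : NC n) (g : ℕ → B) :
    (γ.extBlocks.map fun C => g C.card).prod =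
      relListProd n γ.Rel (fun a => IsBlockMin γ.Rel a ∧ ¬ IsInner γ.Rel a) g := by
  classical
  rw [NC.extBlocks, List.map_map, prod_map_filter, relListProd, ← List.map_coe_finRange_eq_range,
    List.map_map]
  congr 1
  refine List.map_congr_left fun i _ => ?_
  have : (∀ p ∈ γ.block i, i ≤ p) ↔ IsBlockMin γ.Rel i := by
    constructor
    · rintro h b ⟨_, hb, hm⟩
      exact h _ hm
    · intro h p hp
      exact h p ⟨i.2, p.2, hp⟩
  simp only [Function.comp, NC.card_block, this, NC.isInterior_block_iff]

/-- Grouping the blocks of a non-crossing partition into interior and exterior ones does not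
change a product of scalars. -/
theorem NC.prod_blocks_eq {n : ℕ} (γ : NC n) (f : ℕ → ℂ) :
    ∏ C ∈ γ.blocks, f C.card =
      (∏ C ∈ γ.intBlocks, f C.card) • (γ.extBlocks.map fun C => f C.card).prod := by
  classical
  have hl : ∀ h : ℕ → ℂ, ((List.range n).map h).prod = ∏ a ∈ Finset.range n, h a := fun h => rfl
  rw [γ.prod_blocks_min, γ.prod_intBlocks, γ.prod_extBlocks, relListProd, relProd, relProd,
    smul_eq_mul, hl, ← Finset.prod_mul_distrib]
  refine Finset.prod_congr rfl fun a _ => ?_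
  by_cases h1 : IsBlockMin γ.Rel a <;> by_cases h2 : IsInner γ.Rel a <;> simp [h1, h2]

end Relations

/-! ### The relation of the Kreweras complement -/

section Kreweras

/-- Two barred positions `a`, `b` lie in the same block of the Kreweras complement iff no block
of `r` has elements both inside and outside the set of positions between `a` and `b`. -/
def krewerasRel (n : ℕ) (r : ℕ → ℕ → Prop) (a b : ℕ) : Prop :=
  a < n ∧ b < n ∧ ∀ p q, r p q → ((p ≤ a ↔ p ≤ b) ↔ (q ≤ a ↔ q ≤ b))

theorem isNCRel_krewerasRel {n : ℕ} {r : ℕ → ℕ → Prop} : IsNCRel n (krewerasRel n r) := by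
  refine ⟨fun a ha => ⟨ha, ha, by simp⟩, fun a b h => h.1, ?_, ?_, ?_⟩
  · rintro a b ⟨ha, hb, h⟩
    refine ⟨hb, ha, fun p q hpq => ?_⟩
    have := h p q hpq
    tauto
  · rintro a b c ⟨ha, hb, h⟩ ⟨_, hc, h'⟩
    refine ⟨ha, hc, fun p q hpq => ?_⟩
    have := h p q hpq
    have := h' p q hpq
    tauto
  · rintro a b c d hab hbc hcd ⟨ha, hc, h⟩ ⟨hb, hd, h'⟩
    refine ⟨ha, hb, fun p q hpq => ?_⟩
    have h1 := h p q hpq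
    have h2 := h' p q hpq
    clear h h'
    grind

theorem NC.exists_rel_of_mem {n : ℕ} {γ : NC n} {C : Finset (Fin n)} (hC : C ∈ γ.blocks)
    {i j : Fin n} (hi : i ∈ C) (hj : j ∈ C) : γ.Rel i j :=
  NC.rel_iff.2 ((NC.block_eq_of_mem hC hi).trans (NC.block_eq_of_mem hC hj).symm)

theorem nonCrossing_interleave {n : ℕ} {π σ : NC n}
    (h : ∀ a b, σ.Rel a b → krewerasRel n π.Rel a b) : NonCrossing (interleave π σ) := by
  intro C hC D hD hne i k p q hik hkp hpq hmem
  simp only [interleave, Finset.mem_union, Finset.mem_image] at hC hD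
  rcases hC with ⟨C, hC, rfl⟩ | ⟨C, hC, rfl⟩ <;> rcases hD with ⟨D, hD, rfl⟩ | ⟨D, hD, rfl⟩ <;>
    simp only [Finset.mem_image] at hmem <;>
    obtain ⟨⟨i, hi, rfl⟩, ⟨p, hp, rfl⟩, ⟨k, hk, rfl⟩, ⟨q, hq, rfl⟩⟩ := hmem
  · exact π.2 C hC D hD (by rintro rfl; exact hne rfl) i k p q (by omega) (by omega)
      (by omega) ⟨hi, hp, hk, hq⟩
  · have h := (h _ _ (NC.exists_rel_of_mem hD hk hq)).2.2 _ _ (NC.exists_rel_of_mem hC hi hp)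
    omega
  · have h := (h _ _ (NC.exists_rel_of_mem hC hi hp)).2.2 _ _ (NC.exists_rel_of_mem hD hk hq)
    omega
  · exact σ.2 C hC D hD (by rintro rfl; exact hne rfl) i k p q (by omega) (by omega)
      (by omega) ⟨hi, hp, hk, hq⟩

/-- An element of a block of `π` on either side of a barred pair `a < b` of `σ` cannot be joined to
one between them without a crossing. -/
theorem krewerasRel_of_nonCrossing {n : ℕ} {π σ : NC n} (h : NonCrossing (interleave π σ))
    {a b : ℕ} (hab : σ.Rel a b) : krewerasRel n π.Rel a b := by
  have hne : ∀ i j : Fin n, (π.block i).image (fun i : Fin n => 2 * (i : ℕ)) ≠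
      (σ.block j).image (fun i : Fin n => 2 * (i : ℕ) + 1) := by
    intro i j e
    have : 2 * (i : ℕ) ∈ (σ.block j).image (fun i : Fin n => 2 * (i : ℕ) + 1) := by
      rw [← e]; exact Finset.mem_image_of_mem _ (NC.mem_block.2 rfl)
    simp only [Finset.mem_image] at this
    obtain ⟨x, _, hx⟩ := this
    omega
  have hC : ∀ i : Fin n, (π.block i).image (fun i : Fin n => 2 * (i : ℕ)) ∈ interleave π σ :=
    fun i => Finset.mem_union_left _ (Finset.mem_image_of_mem _ (π.block_mem i))
  have hD : ∀ i : Fin n, (σ.block i).image (fun i : Fin n => 2 * (i : ℕ) + 1) ∈ interleave π σ :=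
    fun i => Finset.mem_union_right _ (Finset.mem_image_of_mem _ (σ.block_mem i))
  have mC : ∀ i j : Fin n, j ∈ π.block i →
      2 * (j : ℕ) ∈ (π.block i).image (fun i : Fin n => 2 * (i : ℕ)) :=
    fun i j hj => Finset.mem_image_of_mem (fun i : Fin n => 2 * (i : ℕ)) hj
  have mD : ∀ i j : Fin n, j ∈ σ.block i →
      2 * (j : ℕ) + 1 ∈ (σ.block i).image (fun i : Fin n => 2 * (i : ℕ) + 1) :=
    fun i j hj => Finset.mem_image_of_mem (fun i : Fin n => 2 * (i : ℕ) + 1) hj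
  have key : ∀ a b, σ.Rel a b → a < b → ∀ p q, π.Rel p q → a < p → p ≤ b → a < q ∧ q ≤ b := by
    rintro a b ⟨ha, hb, hm⟩ hab p q ⟨hp, hq, hpq⟩ hap hpb
    have m1 := mD ⟨a, ha⟩ ⟨a, ha⟩ (NC.mem_block.2 rfl)
    have m2 := mD ⟨a, ha⟩ ⟨b, hb⟩ hm
    have m3 := mC ⟨p, hp⟩ ⟨p, hp⟩ (NC.mem_block.2 rfl)
    have m4 := mC ⟨p, hp⟩ ⟨q, hq⟩ hpq
    simp only at m1 m2 m3 m4
    by_contra hcon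
    rcases lt_or_ge a q with h' | h'
    · exact h _ (hD _) _ (hC _) (hne _ _).symm _ _ _ _ (by omega) (by omega) (by omega)
        ⟨m1, m2, m3, m4⟩
    · exact h _ (hC _) _ (hD _) (hne _ _) _ _ _ _ (by omega) (by omega) (by omega)
        ⟨m4, m3, m1, m2⟩
  refine ⟨σ.isNCRel.lt _ _ hab, σ.isNCRel.lt _ _ (σ.isNCRel.symm _ _ hab), fun p q hpq => ?_⟩
  have hqp := π.isNCRel.symm _ _ hpq
  rcases lt_trichotomy a b with hlt | rfl | hlt
  · have e1 := key a b hab hlt p q hpq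
    have e2 := key a b hab hlt q p hqp
    grind
  · simp
  · have e1 := key b a (σ.isNCRel.symm _ _ hab) hlt p q hpq
    have e2 := key b a (σ.isNCRel.symm _ _ hab) hlt q p hqp
    grind

/-- An explicit description of the Kreweras complement: `krewerasRel` is non-crossing and compatible
with `γ`, and it contains every relation that is. -/
theorem NC.rel_Kr {n : ℕ} (γ : NC n) : (Kr γ).Rel = krewerasRel n γ.Rel := by
  funext a b
  refine propext ⟨krewerasRel_of_nonCrossing (isGreatest_Kr γ).1, fun hab => ?_⟩
  have hle : (NC.ofRel (isNCRel_krewerasRel (n := n) (r := γ.Rel))) ≤ Kr γ :=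
    (isGreatest_Kr γ).2 (nonCrossing_interleave fun a b h => by rwa [NC.rel_ofRel] at h)
  rw [← NC.rel_ofRel (isNCRel_krewerasRel (n := n) (r := γ.Rel))] at hab
  obtain ⟨ha, hb, hm⟩ := hab
  obtain ⟨D, hD, hsub⟩ := hle (NC.block_mem _ ⟨a, ha⟩)
  exact NC.exists_rel_of_mem (γ := Kr γ) hD (i := ⟨a, ha⟩) (j := ⟨b, hb⟩)
    (hsub (NC.mem_block.2 rfl)) (hsub hm)

end Kreweras

/-! ### The first-point decomposition -/

section Join

/-- The relation on `{0, …, m + k}` obtained from a relation `r₁` on `{0, …, m - 1}` and a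
relation `r₂` on `{0, …, k - 1}`: the point `0` is followed by a copy of `r₁` and a copy of `r₂`,
and it joins the block of the first element of `r₂`. Because of the truncated subtraction
`a - (m + 1)` sends both `0` and `m + 1` to the first point of `r₂`; the last clause covers the
case that `r₂` is empty. -/
def joinRel (m : ℕ) (r₁ r₂ : ℕ → ℕ → Prop) (a b : ℕ) : Prop :=
  (1 ≤ a ∧ 1 ≤ b ∧ r₁ (a - 1) (b - 1)) ∨
    ((a = 0 ∨ m < a) ∧ (b = 0 ∨ m < b) ∧ r₂ (a - (m + 1)) (b - (m + 1))) ∨ (a = 0 ∧ b = 0)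

variable {m k : ℕ} {r₁ r₂ : ℕ → ℕ → Prop}

theorem isNCRel_joinRel (h₁ : IsNCRel m r₁) (h₂ : IsNCRel k r₂) :
    IsNCRel (m + 1 + k) (joinRel m r₁ r₂) := by
  obtain ⟨f1, l1, s1, t1, n1⟩ := h₁
  obtain ⟨f2, l2, s2, t2, n2⟩ := h₂
  have l1' : ∀ a b, r₁ a b → b < m := fun a b h => l1 _ _ (s1 _ _ h)
  have l2' : ∀ a b, r₂ a b → b < k := fun a b h => l2 _ _ (s2 _ _ h)
  refine ⟨?_, ?_, ?_, ?_, ?_⟩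
  · intro a ha
    rcases Nat.eq_zero_or_pos a with rfl | h0
    · exact Or.inr (Or.inr ⟨rfl, rfl⟩)
    · rcases Nat.lt_or_ge m a with h | h
      · exact Or.inr (Or.inl ⟨Or.inr h, Or.inr h, f2 _ (by omega)⟩)
      · exact Or.inl ⟨h0, h0, f1 _ (by omega)⟩
  · rintro a b (⟨ha, hb, h⟩ | ⟨ha, hb, h⟩ | ⟨rfl, rfl⟩)
    · have := l1 _ _ h; omega
    · have := l2 _ _ h; omega
    · omega
  · rintro a b (⟨ha, hb, h⟩ | ⟨ha, hb, h⟩ | ⟨rfl, rfl⟩)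
    · exact Or.inl ⟨hb, ha, s1 _ _ h⟩
    · exact Or.inr (Or.inl ⟨hb, ha, s2 _ _ h⟩)
    · exact Or.inr (Or.inr ⟨rfl, rfl⟩)
  · rintro a b c (⟨ha, hb, h⟩ | ⟨ha, hb, h⟩ | ⟨rfl, rfl⟩)
      (⟨hb', hc, h'⟩ | ⟨hb', hc, h'⟩ | ⟨hb', rfl⟩)
    · exact Or.inl ⟨ha, hc, t1 _ _ _ h h'⟩
    · have := l1' _ _ h; omega
    · omega
    · have := l1 _ _ h'; omega
    · exact Or.inr (Or.inl ⟨ha, hc, t2 _ _ _ h h'⟩)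
    · exact Or.inr (Or.inl ⟨ha, Or.inl rfl, hb' ▸ h⟩)
    · omega
    · exact Or.inr (Or.inl ⟨hb', hc, h'⟩)
    · exact Or.inr (Or.inr ⟨rfl, rfl⟩)
  · rintro a b c d hab hbc hcd (⟨ha, hc, h⟩ | ⟨ha, hc, h⟩ | ⟨rfl, rfl⟩)
      (⟨hb, hd, h'⟩ | ⟨hb, hd, h'⟩ | ⟨rfl, rfl⟩)
    · exact Or.inl ⟨ha, hb, n1 _ _ _ _ (by omega) (by omega) (by omega) h h'⟩
    · have := l1' _ _ h; omega
    · omega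
    · have := l1' _ _ h'; omega
    · refine Or.inr (Or.inl ⟨ha, hb, ?_⟩)
      rcases Nat.lt_or_ge (a - (m + 1)) (b - (m + 1)) with hlt | hge
      · exact n2 _ _ _ _ hlt (by omega) (by omega) h h'
      · have : a - (m + 1) = b - (m + 1) := by omega
        rw [this]
        exact f2 _ (l2 _ _ h')
    all_goals omega

/-- The non-crossing partition of `n + 1` points obtained from `γ₁` and `γ₂` by adding a first
point that joins the first block of `γ₂` and encloses `γ₁`; it is a singleton block if `γ₂` is
empty. -/
def NC.join {n : ℕ} (h : m + k = n) (γ₁ : NC m) (γ₂ : NC k) : NC (n + 1) :=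
  NC.ofRel (r := joinRel m γ₁.Rel γ₂.Rel)
    (by have := isNCRel_joinRel γ₁.isNCRel γ₂.isNCRel
        rwa [show m + 1 + k = n + 1 by omega] at this)

theorem NC.rel_join {n : ℕ} (h : m + k = n) (γ₁ : NC m) (γ₂ : NC k) :
    (NC.join h γ₁ γ₂).Rel = joinRel m γ₁.Rel γ₂.Rel := NC.rel_ofRel _

theorem joinRel_left {a b : ℕ} (ha : a < m) :
    joinRel m r₁ r₂ (a + 1) (b + 1) ↔ r₁ a b := by
  simp [joinRel]; omega

theorem joinRel_right (h₁ : IsNCRel m r₁) {a b : ℕ} :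
    joinRel m r₁ r₂ (a + (m + 1)) (b + (m + 1)) ↔ r₂ a b := by
  have : ¬ r₁ (a + (m + 1) - 1) (b + (m + 1) - 1) := fun h => by
    have := h₁.lt _ _ h; omega
  simp only [joinRel, this, Nat.add_sub_cancel]
  have h1 : m < a + (m + 1) := by omega
  have h2 : m < b + (m + 1) := by omega
  simp [h1, h2]

/-- Every non-crossing partition of `n + 1` points arises by `NC.join`: the point after which to
cut is determined by the second element of the block of `0`. -/
theorem NC.exists_join {n : ℕ} (γ : NC (n + 1)) :
    ∃ (m k : ℕ) (h : m + k = n) (γ₁ : NC m) (γ₂ : NC k), NC.join h γ₁ γ₂ = γ := by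
  classical
  obtain ⟨f, l, s, t, c⟩ := γ.isNCRel
  have l' : ∀ a b, γ.Rel a b → b < n + 1 := fun a b h => l _ _ (s _ _ h)
  -- `m + 1` is the second element of the block of `0`, and `m = n` if there is none
  obtain ⟨m, hm, hlow, hup⟩ : ∃ m ≤ n, (∀ a, 1 ≤ a → a ≤ m → ¬ γ.Rel 0 a) ∧
      (m < n → γ.Rel 0 (m + 1)) := by
    by_cases hex : ∃ j, 1 ≤ j ∧ γ.Rel 0 j
    · have h1 := Nat.find_spec hex
      have h2 := l' _ _ h1.2
      refine ⟨Nat.find hex - 1, by omega, fun a ha ham h => ?_, fun _ => ?_⟩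
      · exact Nat.find_min hex (m := a) (by omega) ⟨ha, h⟩
      · rw [Nat.sub_add_cancel h1.1]
        exact h1.2
    · push Not at hex
      exact ⟨n, le_rfl, fun a ha _ => hex a ha, fun h => absurd h (lt_irrefl n)⟩
  -- what lies between `0` and `m + 1` is a union of blocks
  have hcross : ∀ a b, 1 ≤ a → a ≤ m → (b = 0 ∨ m < b) → ¬ γ.Rel a b := by
    rintro a b h1 h2 (rfl | hb) h
    · exact hlow a h1 h2 (s _ _ h)
    · have hb' := l' _ _ h
      rcases Nat.eq_or_lt_of_le (show m + 1 ≤ b from hb) with rfl | hlt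
      · exact hlow a h1 h2 (t _ _ _ (hup (by omega)) (s _ _ h))
      · exact hlow a h1 h2 (c 0 a (m + 1) b (by omega) (by omega) hlt (hup (by omega)) h)
  have g₁ : IsNCRel m fun a b => a < m ∧ b < m ∧ γ.Rel (a + 1) (b + 1) :=
    ⟨fun a ha => ⟨ha, ha, f _ (by omega)⟩, fun a b h => h.1, fun a b h => ⟨h.2.1, h.1, s _ _ h.2.2⟩,
      fun a b c h h' => ⟨h.1, h'.2.1, t _ _ _ h.2.2 h'.2.2⟩,
      fun a b d e hab hbd hde h h' => ⟨h.1, h'.1, c _ _ _ _ (by omega) (by omega)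
        (show d + 1 < e + 1 by omega) h.2.2 h'.2.2⟩⟩
  have g₂ : IsNCRel (n - m) fun a b => γ.Rel (a + (m + 1)) (b + (m + 1)) :=
    ⟨fun a ha => f _ (by omega), fun a b h => by have := l _ _ h; omega, fun a b h => s _ _ h,
      fun a b c h h' => t _ _ _ h h',
      fun a b d e hab hbd hde h h' => c _ _ _ _ (by omega) (by omega)
        (show d + (m + 1) < e + (m + 1) by omega) h h'⟩
  refine ⟨m, n - m, by omega, NC.ofRel g₁, NC.ofRel g₂, NC.rel_injective ?_⟩
  rw [NC.rel_join, NC.rel_ofRel, NC.rel_ofRel]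
  funext a b
  refine propext ⟨?_, fun h => ?_⟩
  · rintro (⟨ha, hb, -, -, h⟩ | ⟨ha, hb, h⟩ | ⟨rfl, rfl⟩)
    · rwa [Nat.sub_add_cancel ha, Nat.sub_add_cancel hb] at h
    · have hl := l _ _ h
      have e : ∀ x, (x = 0 ∨ m < x) → x - (m + 1) + (m + 1) < n + 1 →
          γ.Rel x (x - (m + 1) + (m + 1)) := by
        rintro x (rfl | hx) hlt
        · rw [show 0 - (m + 1) + (m + 1) = m + 1 by omega] at hlt ⊢
          exact hup (by omega)
        · rw [Nat.sub_add_cancel hx]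
          rw [Nat.sub_add_cancel hx] at hlt
          exact f _ hlt
      exact t _ _ _ (e a ha (l _ _ h)) (t _ _ _ h (s _ _ (e b hb (l' _ _ h))))
    · exact f _ (by omega)
  · by_cases ha : 1 ≤ a ∧ a ≤ m
    · have hb : 1 ≤ b ∧ b ≤ m := by
        by_contra hb
        exact hcross a b ha.1 ha.2 (by omega) h
      refine Or.inl ⟨ha.1, hb.1, by omega, by omega, ?_⟩
      rwa [Nat.sub_add_cancel ha.1, Nat.sub_add_cancel hb.1]
    · have hb : ¬ (1 ≤ b ∧ b ≤ m) := fun hb => hcross b a hb.1 hb.2 (by omega) (s _ _ h)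
      by_cases h0 : a = 0 ∧ b = 0
      · exact Or.inr (Or.inr h0)
      · refine Or.inr (Or.inl ⟨by omega, by omega, ?_⟩)
        have hla := l _ _ h
        have hlb := l' _ _ h
        have e : ∀ x, (x = 0 ∨ m < x) → x < n + 1 → γ.Rel (x - (m + 1) + (m + 1)) x := by
          rintro x (rfl | hx) hlt
          · rw [show 0 - (m + 1) + (m + 1) = m + 1 by omega]
            exact s _ _ (hup (by omega))
          · rw [Nat.sub_add_cancel hx]
            exact f _ hlt
        exact t _ _ _ (e a (by omega) hla) (t _ _ _ h (s _ _ (e b (by omega) hlb)))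

theorem NC.join_injective {n m k m' k' : ℕ} {h : m + k = n} {h' : m' + k' = n} {γ₁ : NC m}
    {γ₂ : NC k} {γ₁' : NC m'} {γ₂' : NC k'} (he : NC.join h γ₁ γ₂ = NC.join h' γ₁' γ₂') :
    m = m' ∧ HEq γ₁ γ₁' ∧ HEq γ₂ γ₂' := by
  have hr : joinRel m γ₁.Rel γ₂.Rel = joinRel m' γ₁'.Rel γ₂'.Rel := by
    rw [← NC.rel_join h, ← NC.rel_join h', he]
  -- the second element of the block of `0` is at `m + 1`
  have hle : ∀ {m k m' k' : ℕ} (_ : m + k = n) (_ : m' + k' = n) (γ₁ : NC m) (γ₂ : NC k)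
      (γ₁' : NC m') (γ₂' : NC k'), joinRel m γ₁.Rel γ₂.Rel = joinRel m' γ₁'.Rel γ₂'.Rel →
      m ≤ m' := by
    intro m k m' k' h h' γ₁ γ₂ γ₁' γ₂' hr
    by_contra hlt
    have h1 : joinRel m' γ₁'.Rel γ₂'.Rel 0 (m' + 1) := by
      refine Or.inr (Or.inl ⟨Or.inl rfl, Or.inr (by omega), ?_⟩)
      simpa using γ₂'.isNCRel.refl 0 (by omega)
    rw [← hr] at h1
    rcases h1 with h1 | h1 | h1 <;> omega
  obtain rfl : m = m' := le_antisymm (hle h h' γ₁ γ₂ γ₁' γ₂' hr) (hle h' h γ₁' γ₂' γ₁ γ₂ hr.symm)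
  obtain rfl : k = k' := by omega
  refine ⟨rfl, heq_of_eq (NC.rel_injective ?_), heq_of_eq (NC.rel_injective ?_)⟩
  · funext a b
    by_cases hab : a < m ∧ b < m
    · rw [← joinRel_left (r₁ := γ₁.Rel) hab.1, hr,
        joinRel_left hab.1]
    · refine propext ⟨fun h => ?_, fun h => ?_⟩
      · exact absurd ⟨γ₁.isNCRel.lt _ _ h, γ₁.isNCRel.lt _ _ (γ₁.isNCRel.symm _ _ h)⟩ hab
      · exact absurd ⟨γ₁'.isNCRel.lt _ _ h, γ₁'.isNCRel.lt _ _ (γ₁'.isNCRel.symm _ _ h)⟩ hab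
  · funext a b
    rw [← joinRel_right γ₁.isNCRel (r₂ := γ₂.Rel), hr, joinRel_right γ₁'.isNCRel]

/-- The first-point decomposition of sums over non-crossing partitions. -/
theorem sum_NC_succ {M : Type*} [AddCommMonoid M] (n : ℕ) (F : NC (n + 1) → M) :
    ∑ γ, F γ = ∑ p : Finset.HasAntidiagonal.antidiagonal n, ∑ γ₁ : NC p.1.1, ∑ γ₂ : NC p.1.2,
      F (NC.join (Finset.HasAntidiagonal.mem_antidiagonal.1 p.2) γ₁ γ₂) := by
  simp_rw [← Fintype.sum_prod_type' fun _ _ => _]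
  rw [← Fintype.sum_sigma']
  symm
  refine Fintype.sum_bijective (fun x : (p : Finset.HasAntidiagonal.antidiagonal n) ×
    (NC p.1.1 × NC p.1.2) =>
      NC.join (Finset.HasAntidiagonal.mem_antidiagonal.1 x.1.2) x.2.1 x.2.2) ⟨?_, ?_⟩ _ _
    fun _ => rfl
  · rintro ⟨⟨⟨m, k⟩, h⟩, γ₁, γ₂⟩ ⟨⟨⟨m', k'⟩, h'⟩, γ₁', γ₂'⟩ he
    obtain ⟨hm, e1, e2⟩ := NC.join_injective he
    simp only [Finset.HasAntidiagonal.mem_antidiagonal] at h h' hm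
    subst hm
    obtain rfl : k = k' := by omega
    cases eq_of_heq e1
    cases eq_of_heq e2
    rfl
  · intro γ
    obtain ⟨m, k, h, γ₁, γ₂, rfl⟩ := γ.exists_join
    exact ⟨⟨⟨(m, k), Finset.HasAntidiagonal.mem_antidiagonal.2 h⟩, γ₁, γ₂⟩, rfl⟩

end Join

/-! ### Block weights under the first-point decomposition -/

section Weights

variable {m k : ℕ} {r₁ r₂ : ℕ → ℕ → Prop}

theorem ite_of_iff {α : Type*} {p q : Prop} {_ : Decidable p} {_ : Decidable q} (h : p ↔ q)
    (x y : α) : ite p x y = ite q x y := if_congr h rfl rfl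

@[to_additive]
theorem prod_range_join {M : Type*} [CommMonoid M] (m k : ℕ) (F : ℕ → M) :
    ∏ a ∈ Finset.range (m + 1 + k), F a =
      F 0 * (∏ a ∈ Finset.range m, F (a + 1)) * ∏ a ∈ Finset.range k, F (a + (m + 1)) := by
  rw [Finset.prod_range_add, Finset.prod_range_succ', mul_comm (F 0)]
  simp only [add_comm (m + 1)]

theorem list_prod_range_join {M : Type*} [Monoid M] (m k : ℕ) (F : ℕ → M) :
    ((List.range (m + 1 + k)).map F).prod =
      F 0 * ((List.range m).map fun a => F (a + 1)).prod *
        ((List.range k).map fun a => F (a + (m + 1))).prod := by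
  rw [List.range_add, List.range_succ_eq_map]
  simp [Function.comp_def, add_comm (m + 1), mul_assoc]

theorem joinRel_zero_zero : joinRel m r₁ r₂ 0 0 := Or.inr (Or.inr ⟨rfl, rfl⟩)

theorem joinRel_zero_left {b : ℕ} (hb : b < m) : ¬ joinRel m r₁ r₂ 0 (b + 1) := by
  simp [joinRel]; omega

theorem joinRel_left_zero {b : ℕ} (hb : b < m) : ¬ joinRel m r₁ r₂ (b + 1) 0 := by
  simp [joinRel]; omega

theorem joinRel_zero_right {b : ℕ} : joinRel m r₁ r₂ 0 (b + (m + 1)) ↔ r₂ 0 b := by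
  simp [joinRel]; omega

theorem joinRel_right_zero {b : ℕ} : joinRel m r₁ r₂ (b + (m + 1)) 0 ↔ r₂ b 0 := by
  simp [joinRel]; omega

theorem joinRel_left_right (h₁ : IsNCRel m r₁) {a b : ℕ} (ha : a < m) :
    ¬ joinRel m r₁ r₂ (a + 1) (b + (m + 1)) := by
  rintro (⟨_, _, h⟩ | ⟨h, _, _⟩ | ⟨h, _⟩)
  · have := h₁.lt _ _ (h₁.symm _ _ h)
    omega
  · omega
  · omega

theorem joinRel_right_left (h₁ : IsNCRel m r₁) {a b : ℕ} (ha : a < m) :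
    ¬ joinRel m r₁ r₂ (b + (m + 1)) (a + 1) := by
  rintro (⟨_, _, h⟩ | ⟨_, h, _⟩ | ⟨h, _⟩)
  · have := h₁.lt _ _ h
    omega
  · omega
  · omega

theorem relSize_join_left (h₁ : IsNCRel m r₁) {a : ℕ} (ha : a < m) :
    relSize (m + 1 + k) (joinRel m r₁ r₂) (a + 1) = relSize m r₁ a := by
  rw [relSize, sum_range_join, if_neg (joinRel_left_zero ha), zero_add,
    Finset.sum_eq_zero (s := Finset.range k) fun b _ => if_neg (joinRel_left_right h₁ ha), add_zero]
  exact Finset.sum_congr rfl fun b _ => ite_of_iff (joinRel_left ha) _ _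

theorem relSize_join_right (h₁ : IsNCRel m r₁) {a : ℕ} (h : ¬ r₂ a 0) :
    relSize (m + 1 + k) (joinRel m r₁ r₂) (a + (m + 1)) = relSize k r₂ a := by
  rw [relSize, sum_range_join, if_neg (by rwa [joinRel_right_zero]), Finset.sum_eq_zero]
  · rw [zero_add, zero_add]
    exact Finset.sum_congr rfl fun b _ => ite_of_iff (joinRel_right h₁) _ _
  · intro b hb
    rw [if_neg (joinRel_right_left h₁ (Finset.mem_range.1 hb))]

theorem relSize_join_zero : relSize (m + 1 + k) (joinRel m r₁ r₂) 0 = relSize k r₂ 0 + 1 := by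
  rw [relSize, sum_range_join, if_pos joinRel_zero_zero, Finset.sum_eq_zero]
  · rw [add_zero, add_comm]
    congr 1
    exact Finset.sum_congr rfl fun b _ => ite_of_iff joinRel_zero_right _ _
  · intro b hb
    rw [if_neg (joinRel_zero_left (Finset.mem_range.1 hb))]

theorem isBlockMin_join_left {a : ℕ} (ha : a < m) :
    IsBlockMin (joinRel m r₁ r₂) (a + 1) ↔ IsBlockMin r₁ a := by
  constructor
  · intro h b hab
    have := h (b + 1) ((joinRel_left ha).2 hab)
    omega
  · intro h b hab
    rcases Nat.eq_zero_or_pos b with rfl | hb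
    · exact absurd hab (joinRel_left_zero ha)
    · obtain ⟨b, rfl⟩ : ∃ c, b = c + 1 := ⟨b - 1, by omega⟩
      have := h b ((joinRel_left ha).1 hab)
      omega

theorem isBlockMin_join_right (h₁ : IsNCRel m r₁) (h₂ : IsNCRel k r₂) {a : ℕ} (ha : a < k) :
    IsBlockMin (joinRel m r₁ r₂) (a + (m + 1)) ↔ IsBlockMin r₂ a ∧ a ≠ 0 := by
  constructor
  · intro h
    refine ⟨fun b hab => ?_, ?_⟩
    · have := h _ ((joinRel_right h₁).2 hab)
      omega
    · rintro rfl
      have := h 0 (joinRel_right_zero.2 (h₂.refl _ ha))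
      omega
  · rintro ⟨h, h0⟩ b hab
    by_contra hlt
    rcases Nat.eq_zero_or_pos b with rfl | hb
    · have := h 0 (joinRel_right_zero.1 hab)
      omega
    rcases Nat.lt_or_ge m b with hb' | hb'
    · obtain ⟨b, rfl⟩ : ∃ c, b = c + (m + 1) := ⟨b - (m + 1), by omega⟩
      have := h b ((joinRel_right h₁).1 hab)
      omega
    · obtain ⟨b, rfl⟩ : ∃ c, b = c + 1 := ⟨b - 1, by omega⟩
      exact joinRel_right_left h₁ (by omega) hab

theorem isBlockMin_zero (r : ℕ → ℕ → Prop) : IsBlockMin r 0 := fun _ _ => Nat.zero_le _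

theorem not_isInner_zero (r : ℕ → ℕ → Prop) : ¬ IsInner r 0 := by
  rintro ⟨i, j, h, -⟩
  omega

/-- If `r₂` is not empty then `r₁` lies under the arc from `0` to the first element of `r₂`. -/
theorem isInner_join_left (h₂ : IsNCRel k r₂) (hk : 0 < k) {a : ℕ} (ha : a < m) :
    IsInner (joinRel m r₁ r₂) (a + 1) :=
  ⟨0, 0 + (m + 1), by omega, by omega, joinRel_zero_right.2 (h₂.refl _ hk), joinRel_zero_left ha⟩

/-- If `r₂` is empty then the point `0` is a singleton block and `r₁` keeps its exterior blocks. -/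
theorem isInner_join_left_of_empty (h₁ : IsNCRel m r₁) (h₂ : IsNCRel 0 r₂) {a : ℕ} :
    IsInner (joinRel m r₁ r₂) (a + 1) ↔ IsInner r₁ a := by
  constructor
  · rintro ⟨i, j, hi, hj, (⟨h1, h2, h⟩ | ⟨_, _, h⟩ | h), hia⟩
    · refine ⟨i - 1, j - 1, by omega, by omega, h, fun h' => hia (Or.inl ⟨h1, by omega, h'⟩)⟩
    · have := h₂.lt _ _ h
      omega
    · omega
  · rintro ⟨i, j, hi, hj, h, hia⟩
    refine ⟨i + 1, j + 1, by omega, by omega, (joinRel_left (h₁.lt _ _ h)).2 h,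
      fun h' => hia ((joinRel_left (h₁.lt _ _ h)).1 h')⟩

theorem isInner_join_right (h₁ : IsNCRel m r₁) {a : ℕ} (ha : a ≠ 0) :
    IsInner (joinRel m r₁ r₂) (a + (m + 1)) ↔ IsInner r₂ a := by
  constructor
  · rintro ⟨i, j, hi, hj, (⟨h1, h2, h⟩ | ⟨hi', _, h⟩ | h), hia⟩
    · have := h₁.lt _ _ (h₁.symm _ _ h)
      omega
    · refine ⟨i - (m + 1), j - (m + 1), by omega, by omega, h, fun h' => hia ?_⟩
      exact Or.inr (Or.inl ⟨hi', by omega, by rwa [Nat.add_sub_cancel]⟩)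
    · omega
  · rintro ⟨i, j, hi, hj, h, hia⟩
    exact ⟨i + (m + 1), j + (m + 1), by omega, by omega, (joinRel_right h₁).2 h,
      fun h' => hia ((joinRel_right h₁).1 h')⟩

theorem IsBlockMin.not_rel_zero {r : ℕ → ℕ → Prop} {a : ℕ} (h : IsBlockMin r a) (ha : a ≠ 0) :
    ¬ r a 0 := fun h0 => by
  have := h 0 h0
  omega

theorem relProd_join_min (h₁ : IsNCRel m r₁) (h₂ : IsNCRel k r₂) (f : ℕ → ℂ) :
    relProd (m + 1 + k) (joinRel m r₁ r₂) (fun a => IsBlockMin (joinRel m r₁ r₂) a ∧ a ≠ 0) f =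
      relProd m r₁ (IsBlockMin r₁) f * relProd k r₂ (fun a => IsBlockMin r₂ a ∧ a ≠ 0) f := by
  rw [relProd, prod_range_join, if_neg (by simp), one_mul, relProd, relProd]
  congr 1
  · refine Finset.prod_congr rfl fun a ha => ?_
    have ha := Finset.mem_range.1 ha
    rw [relSize_join_left h₁ ha, isBlockMin_join_left ha]
    exact ite_of_iff (and_iff_left (Nat.succ_ne_zero a)) _ _
  · refine Finset.prod_congr rfl fun a ha => ?_
    have ha := Finset.mem_range.1 ha
    rw [isBlockMin_join_right h₁ h₂ ha]
    by_cases h : IsBlockMin r₂ a ∧ a ≠ 0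
    · rw [relSize_join_right h₁ (h.1.not_rel_zero h.2)]
      exact ite_of_iff (and_iff_left (by omega)) _ _
    · rw [if_neg h, if_neg fun h' => h h'.1]

theorem relProd_join_inner (h₁ : IsNCRel m r₁) (h₂ : IsNCRel k r₂) (hk : 0 < k) (f : ℕ → ℂ) :
    relProd (m + 1 + k) (joinRel m r₁ r₂)
        (fun a => IsBlockMin (joinRel m r₁ r₂) a ∧ IsInner (joinRel m r₁ r₂) a) f =
      relProd m r₁ (IsBlockMin r₁) f *
        relProd k r₂ (fun a => IsBlockMin r₂ a ∧ IsInner r₂ a) f := by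
  rw [relProd, prod_range_join, if_neg fun h => not_isInner_zero _ h.2, one_mul, relProd, relProd]
  congr 1
  · refine Finset.prod_congr rfl fun a ha => ?_
    have ha := Finset.mem_range.1 ha
    rw [relSize_join_left h₁ ha, isBlockMin_join_left ha]
    exact ite_of_iff (and_iff_left (isInner_join_left h₂ hk ha)) _ _
  · refine Finset.prod_congr rfl fun a ha => ?_
    have ha := Finset.mem_range.1 ha
    rw [isBlockMin_join_right h₁ h₂ ha]
    by_cases h : IsBlockMin r₂ a ∧ a ≠ 0
    · rw [relSize_join_right h₁ (h.1.not_rel_zero h.2), isInner_join_right h₁ h.2]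
      exact ite_of_iff (by simp [h]) _ _
    · rw [if_neg fun h' => h h'.1, if_neg]
      rintro ⟨h1, h2⟩
      refine h ⟨h1, ?_⟩
      rintro rfl
      exact not_isInner_zero _ h2

theorem relProd_join_inner_of_empty (h₁ : IsNCRel m r₁) (h₂ : IsNCRel 0 r₂) (f : ℕ → ℂ) :
    relProd (m + 1 + 0) (joinRel m r₁ r₂)
        (fun a => IsBlockMin (joinRel m r₁ r₂) a ∧ IsInner (joinRel m r₁ r₂) a) f =
      relProd m r₁ (fun a => IsBlockMin r₁ a ∧ IsInner r₁ a) f := by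
  rw [relProd, prod_range_join, if_neg fun h => not_isInner_zero _ h.2, one_mul, relProd,
    Finset.prod_range_zero, mul_one]
  refine Finset.prod_congr rfl fun a ha => ?_
  have ha := Finset.mem_range.1 ha
  rw [relSize_join_left h₁ ha, isBlockMin_join_left ha, isInner_join_left_of_empty h₁ h₂]

variable {B : Type*} [Ring B]

theorem relListProd_join_outer (h₁ : IsNCRel m r₁) (h₂ : IsNCRel k r₂) (hk : 0 < k) (g : ℕ → B) :
    relListProd (m + 1 + k) (joinRel m r₁ r₂) (fun a => (IsBlockMin (joinRel m r₁ r₂) a ∧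
        ¬ IsInner (joinRel m r₁ r₂) a) ∧ a ≠ 0) g =
      relListProd k r₂ (fun a => (IsBlockMin r₂ a ∧ ¬ IsInner r₂ a) ∧ a ≠ 0) g := by
  rw [relListProd, list_prod_range_join, if_neg (by simp), one_mul, relListProd,
    List.prod_eq_one, one_mul]
  · congr 1
    refine List.map_congr_left fun a ha => ?_
    have ha := List.mem_range.1 ha
    rw [isBlockMin_join_right h₁ h₂ ha]
    by_cases h : IsBlockMin r₂ a ∧ a ≠ 0
    · rw [relSize_join_right h₁ (h.1.not_rel_zero h.2), isInner_join_right h₁ h.2]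
      exact ite_of_iff (by simp [h]) _ _
    · rw [if_neg fun h' => h h'.1.1, if_neg fun h' => h ⟨h'.1.1, h'.2⟩]
  · intro x hx
    obtain ⟨a, ha, rfl⟩ := List.mem_map.1 hx
    rw [if_neg fun h => h.1.2 (isInner_join_left h₂ hk (List.mem_range.1 ha))]

theorem relListProd_join_outer_of_empty (h₁ : IsNCRel m r₁) (h₂ : IsNCRel 0 r₂) (g : ℕ → B) :
    relListProd (m + 1 + 0) (joinRel m r₁ r₂) (fun a => (IsBlockMin (joinRel m r₁ r₂) a ∧
        ¬ IsInner (joinRel m r₁ r₂) a) ∧ a ≠ 0) g =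
      relListProd m r₁ (fun a => IsBlockMin r₁ a ∧ ¬ IsInner r₁ a) g := by
  rw [relListProd, list_prod_range_join, if_neg (by simp), one_mul, relListProd, List.range_zero,
    List.map_nil, List.prod_nil, mul_one]
  congr 1
  refine List.map_congr_left fun a ha => ?_
  have ha := List.mem_range.1 ha
  rw [relSize_join_left h₁ ha, isBlockMin_join_left ha, isInner_join_left_of_empty h₁ h₂]
  exact ite_of_iff (and_iff_left (Nat.succ_ne_zero a)) _ _

/-- The block of `0` is exterior and comes first. -/
theorem relListProd_outer_eq {n : ℕ} (hn : 0 < n) (r : ℕ → ℕ → Prop) (g : ℕ → B) :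
    relListProd n r (fun a => IsBlockMin r a ∧ ¬ IsInner r a) g =
      g (relSize n r 0) *
        relListProd n r (fun a => (IsBlockMin r a ∧ ¬ IsInner r a) ∧ a ≠ 0) g := by
  obtain ⟨n, rfl⟩ : ∃ k, n = k + 1 := ⟨n - 1, by omega⟩
  rw [relListProd, relListProd, List.range_succ_eq_map, List.map_cons, List.map_cons,
    List.prod_cons, List.prod_cons, if_pos ⟨isBlockMin_zero r, not_isInner_zero r⟩,
    if_neg (by simp), one_mul, List.map_map, List.map_map]
  congr 2
  exact List.map_congr_left fun a _ => ite_of_iff (and_iff_left (Nat.succ_ne_zero a)).symm _ _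

theorem relProd_min_eq {n : ℕ} (hn : 0 < n) (r : ℕ → ℕ → Prop) (f : ℕ → ℂ) :
    relProd n r (IsBlockMin r) f =
      f (relSize n r 0) * relProd n r (fun a => IsBlockMin r a ∧ a ≠ 0) f := by
  obtain ⟨n, rfl⟩ : ∃ k, n = k + 1 := ⟨n - 1, by omega⟩
  rw [relProd, relProd, Finset.prod_range_succ', Finset.prod_range_succ', mul_comm,
    if_pos (isBlockMin_zero r), if_neg (by simp), mul_one]
  congr 1
  exact Finset.prod_congr rfl fun a _ => ite_of_iff (and_iff_left (Nat.succ_ne_zero a)).symm _ _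

end Weights

/-! ### Block weights of the Kreweras complement -/

section Glue

variable {m k : ℕ} {d₁ d₂ : ℕ → ℕ → Prop}

/-- The relation on `{0, …, m + k}` obtained from a relation `d₁` on `{0, …, m - 1}` and a
relation `d₂` on `{0, …, k - 1}`: the point `0` is followed by a copy of `d₁` and a copy of `d₂`,
and it joins the block of the last element of `d₁`. It is the mirror image of `joinRel`. -/
def glueRel (m : ℕ) (d₁ d₂ : ℕ → ℕ → Prop) (a b : ℕ) : Prop :=
  (a ≤ m ∧ b ≤ m ∧ d₁ (if a = 0 then m - 1 else a - 1) (if b = 0 then m - 1 else b - 1)) ∨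
    (m < a ∧ m < b ∧ d₂ (a - (m + 1)) (b - (m + 1))) ∨ (a = 0 ∧ b = 0)

theorem glueRel_zero_zero : glueRel m d₁ d₂ 0 0 := Or.inr (Or.inr ⟨rfl, rfl⟩)

theorem glueRel_left {a b : ℕ} (ha : a < m) (hb : b < m) :
    glueRel m d₁ d₂ (a + 1) (b + 1) ↔ d₁ a b := by
  have h1 : a + 1 ≤ m := ha
  have h2 : b + 1 ≤ m := hb
  simp [glueRel, h1, h2, not_lt.2 h1]

theorem glueRel_zero_left {b : ℕ} (hb : b < m) :
    glueRel m d₁ d₂ 0 (b + 1) ↔ d₁ (m - 1) b := by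
  simp [glueRel]; omega

theorem glueRel_left_zero {b : ℕ} (hb : b < m) :
    glueRel m d₁ d₂ (b + 1) 0 ↔ d₁ b (m - 1) := by
  simp [glueRel]; omega

theorem glueRel_right {a b : ℕ} :
    glueRel m d₁ d₂ (a + (m + 1)) (b + (m + 1)) ↔ d₂ a b := by
  have h1 : ¬ a + (m + 1) ≤ m := by omega
  have h2 : m < a + (m + 1) := by omega
  have h3 : m < b + (m + 1) := by omega
  simp [glueRel, h1, h2, h3]

theorem not_glueRel_of_le_of_lt {a b : ℕ} (ha : a ≤ m) (hb : m < b) : ¬ glueRel m d₁ d₂ a b := by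
  simp [glueRel]; omega

theorem not_glueRel_of_lt_of_le {a b : ℕ} (ha : m < a) (hb : b ≤ m) : ¬ glueRel m d₁ d₂ a b := by
  simp [glueRel]; omega

theorem relSize_glue_left {a : ℕ} (ha : a < m) (h : ¬ d₁ a (m - 1)) :
    relSize (m + 1 + k) (glueRel m d₁ d₂) (a + 1) = relSize m d₁ a := by
  rw [relSize, sum_range_join, if_neg (by rwa [glueRel_left_zero ha]), zero_add,
    Finset.sum_eq_zero (s := Finset.range k) fun b _ =>
      if_neg (not_glueRel_of_le_of_lt (by omega) (by omega)), add_zero]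
  exact Finset.sum_congr rfl fun b hb => ite_of_iff (glueRel_left ha (Finset.mem_range.1 hb)) _ _

theorem relSize_glue_right {a : ℕ} :
    relSize (m + 1 + k) (glueRel m d₁ d₂) (a + (m + 1)) = relSize k d₂ a := by
  rw [relSize, sum_range_join, if_neg (not_glueRel_of_lt_of_le (by omega) (by omega)), zero_add,
    Finset.sum_eq_zero (s := Finset.range m) fun b hb =>
      if_neg (not_glueRel_of_lt_of_le (by omega) (Finset.mem_range.1 hb)), zero_add]
  exact Finset.sum_congr rfl fun b _ => ite_of_iff glueRel_right _ _

/-- The point `0` is added to the block of the last element of `d₁`, which is at position `m`; for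
`m = 0` the block of `0` is a singleton. -/
theorem relSize_glue_last (h₁ : IsNCRel m d₁) :
    relSize (m + 1 + k) (glueRel m d₁ d₂) m = relSize m d₁ (m - 1) + 1 := by
  rw [relSize, sum_range_join, Finset.sum_eq_zero (s := Finset.range k) fun b _ =>
      if_neg (not_glueRel_of_le_of_lt (by omega) (by omega)), add_zero, add_comm]
  rcases Nat.eq_zero_or_pos m with rfl | hm
  · rw [if_pos glueRel_zero_zero, Finset.sum_range_zero, relSize, Finset.sum_range_zero]
  · obtain ⟨m, rfl⟩ : ∃ l, m = l + 1 := ⟨m - 1, by omega⟩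
    rw [if_pos ((glueRel_left_zero (Nat.lt_succ_self m)).2 (h₁.refl _ (Nat.lt_succ_self m)))]
    congr 1
    exact Finset.sum_congr rfl fun b hb =>
      ite_of_iff (glueRel_left (Nat.lt_succ_self m) (Finset.mem_range.1 hb)) _ _

theorem isBlockMax_glue_left {a : ℕ} (ha : a < m) (h₁ : IsNCRel m d₁) :
    IsBlockMax (glueRel m d₁ d₂) (a + 1) ↔ IsBlockMax d₁ a := by
  constructor
  · intro h b hab
    have := h (b + 1) ((glueRel_left ha (h₁.lt _ _ (h₁.symm _ _ hab))).2 hab)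
    omega
  · intro h b hab
    rcases Nat.eq_zero_or_pos b with rfl | hb
    · omega
    rcases Nat.lt_or_ge m b with hb' | hb'
    · exact absurd hab (not_glueRel_of_le_of_lt (by omega) hb')
    · obtain ⟨b, rfl⟩ : ∃ c, b = c + 1 := ⟨b - 1, by omega⟩
      have := h b ((glueRel_left ha (by omega)).1 hab)
      omega

theorem isBlockMax_glue_right {a : ℕ} :
    IsBlockMax (glueRel m d₁ d₂) (a + (m + 1)) ↔ IsBlockMax d₂ a := by
  constructor
  · intro h b hab
    have := h _ (glueRel_right.2 hab)
    omega
  · intro h b hab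
    rcases Nat.lt_or_ge m b with hb' | hb'
    · obtain ⟨b, rfl⟩ : ∃ c, b = c + (m + 1) := ⟨b - (m + 1), by omega⟩
      have := h b (glueRel_right.1 hab)
      omega
    · exact absurd hab (not_glueRel_of_lt_of_le (by omega) hb')

theorem not_isBlockMax_glue_zero (hm : 0 < m) (h₁ : IsNCRel m d₁) :
    ¬ IsBlockMax (glueRel m d₁ d₂) 0 := by
  intro h
  obtain ⟨m, rfl⟩ : ∃ l, m = l + 1 := ⟨m - 1, by omega⟩
  have := h (m + 1) ((glueRel_zero_left (Nat.lt_succ_self m)).2 (h₁.refl _ (Nat.lt_succ_self m)))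
  omega

theorem isBlockMax_glue_zero : IsBlockMax (glueRel 0 d₁ d₂) 0 := by
  intro b hb
  by_contra h
  exact not_glueRel_of_le_of_lt le_rfl (not_le.1 h) hb

theorem IsBlockMax.not_rel_last {r : ℕ → ℕ → Prop} {a : ℕ} (h : IsBlockMax r a) (ha : a < m)
    (hne : a + 1 ≠ m) : ¬ r a (m - 1) := fun h0 => by
  have := h _ h0
  omega

theorem relProd_glue_of_empty (h₁ : IsNCRel m d₁) (f : ℕ → ℂ) :
    relProd (m + 1 + 0) (glueRel m d₁ d₂)
        (fun a => IsBlockMax (glueRel m d₁ d₂) a ∧ a + 1 ≠ m + 1 + 0) f =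
      relProd m d₁ (fun a => IsBlockMax d₁ a ∧ a + 1 ≠ m) f := by
  rw [relProd, prod_range_join, Finset.prod_range_zero, mul_one, if_neg, one_mul]
  · refine Finset.prod_congr rfl fun a ha => ?_
    have ha := Finset.mem_range.1 ha
    rw [isBlockMax_glue_left ha h₁]
    by_cases h : IsBlockMax d₁ a ∧ a + 1 ≠ m
    · rw [if_pos h, if_pos ⟨h.1, by omega⟩, relSize_glue_left ha (h.1.not_rel_last ha h.2)]
    · rw [if_neg h, if_neg fun h' => h ⟨h'.1, by omega⟩]
  · rintro ⟨h, h'⟩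
    exact not_isBlockMax_glue_zero (by omega) h₁ h

theorem relProd_glue (h₁ : IsNCRel m d₁) (hk : 0 < k) (f : ℕ → ℂ) :
    relProd (m + 1 + k) (glueRel m d₁ d₂)
        (fun a => IsBlockMax (glueRel m d₁ d₂) a ∧ a + 1 ≠ m + 1 + k) f =
      relProd m d₁ (fun a => IsBlockMax d₁ a ∧ a + 1 ≠ m) f * f (relSize m d₁ (m - 1) + 1) *
        relProd k d₂ (fun a => IsBlockMax d₂ a ∧ a + 1 ≠ k) f := by
  rw [relProd, prod_range_join]
  congr 1
  · rw [← relSize_glue_last (k := k) (d₂ := d₂) h₁]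
    rcases Nat.eq_zero_or_pos m with rfl | hm
    · rw [relProd, Finset.prod_range_zero, Finset.prod_range_zero, mul_one, one_mul,
        if_pos ⟨isBlockMax_glue_zero, by omega⟩]
    · rw [if_neg fun h => not_isBlockMax_glue_zero hm h₁ h.1, one_mul]
      obtain ⟨m, rfl⟩ : ∃ l, m = l + 1 := ⟨m - 1, by omega⟩
      rw [relProd, Finset.prod_range_succ, Finset.prod_range_succ,
        if_neg (c := IsBlockMax d₁ m ∧ m + 1 ≠ m + 1) (by simp), mul_one]
      congr 1
      · refine Finset.prod_congr rfl fun a ha => ?_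
        have ha := Finset.mem_range.1 ha
        have ha' : a < m + 1 := by omega
        rw [isBlockMax_glue_left ha' h₁]
        by_cases h : IsBlockMax d₁ a
        · rw [if_pos ⟨h, by omega⟩, if_pos ⟨h, by omega⟩,
            relSize_glue_left ha' (h.not_rel_last ha' (by omega))]
        · rw [if_neg fun h' => h h'.1, if_neg fun h' => h h'.1]
      · have hmax : IsBlockMax (glueRel (m + 1) d₁ d₂) (m + 1) := by
          rw [isBlockMax_glue_left (Nat.lt_succ_self m) h₁]
          intro b hb
          have := h₁.lt _ _ (h₁.symm _ _ hb)
          omega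
        exact if_pos ⟨hmax, by omega⟩
  · refine Finset.prod_congr rfl fun a _ => ?_
    rw [isBlockMax_glue_right, relSize_glue_right]
    exact ite_of_iff (and_congr_right fun _ => by omega) _ _

/-- The Kreweras complement turns the first-point decomposition into the mirrored one. -/
theorem krewerasRel_joinRel {r₁ r₂ : ℕ → ℕ → Prop} (h₁ : IsNCRel m r₁) (h₂ : IsNCRel k r₂) :
    krewerasRel (m + 1 + k) (joinRel m r₁ r₂) =
      glueRel m (krewerasRel m r₁) (krewerasRel k r₂) := by
  -- the interval between `a ≤ m` and `b > m` contains `m + 1` but not `0`, which are joined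
  have hlr : ∀ a b, a ≤ m → m < b → ¬ krewerasRel (m + 1 + k) (joinRel m r₁ r₂) a b := by
    rintro a b ha hb ⟨_, hb', h⟩
    have := h 0 (0 + (m + 1)) (joinRel_zero_right.2 (h₂.refl 0 (by omega)))
    omega
  funext a b
  refine propext ?_
  rcases Nat.lt_or_ge m a with ha | ha <;> rcases Nat.lt_or_ge m b with hb | hb
  · obtain ⟨a, rfl⟩ : ∃ c, a = c + (m + 1) := ⟨a - (m + 1), by omega⟩
    obtain ⟨b, rfl⟩ : ∃ c, b = c + (m + 1) := ⟨b - (m + 1), by omega⟩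
    rw [glueRel_right]
    constructor
    · rintro ⟨ha', hb', h⟩
      refine ⟨by omega, by omega, fun p q hpq => ?_⟩
      have := h _ _ ((joinRel_right h₁).2 hpq)
      simpa using this
    · rintro ⟨ha', hb', h⟩
      refine ⟨by omega, by omega, ?_⟩
      rintro p q (⟨hp, hq, hpq⟩ | ⟨hp, hq, hpq⟩ | ⟨rfl, rfl⟩)
      · have := h₁.lt _ _ hpq
        have := h₁.lt _ _ (h₁.symm _ _ hpq)
        omega
      · have := h _ _ hpq
        omega
      · omega
  · exact iff_of_false (fun h => hlr b a hb ha (isNCRel_krewerasRel.symm _ _ h))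
      (not_glueRel_of_lt_of_le ha hb)
  · exact iff_of_false (hlr a b ha hb) (not_glueRel_of_le_of_lt ha hb)
  · constructor
    · rintro ⟨ha', hb', h⟩
      rcases Nat.eq_zero_or_pos m with rfl | hm
      · exact Or.inr (Or.inr ⟨by omega, by omega⟩)
      refine Or.inl ⟨ha, hb, by split_ifs <;> omega, by split_ifs <;> omega, fun p q hpq => ?_⟩
      have hp := h₁.lt _ _ hpq
      have hq := h₁.lt _ _ (h₁.symm _ _ hpq)
      have := h _ _ ((joinRel_left hp).2 hpq)
      split_ifs <;> omega
    · rintro (⟨-, -, ha', hb', h⟩ | ⟨h, -⟩ | ⟨rfl, rfl⟩)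
      · refine ⟨by omega, by omega, ?_⟩
        rintro p q (⟨hp, hq, hpq⟩ | ⟨hp, hq, hpq⟩ | ⟨rfl, rfl⟩)
        · have hp' := h₁.lt _ _ hpq
          have hq' := h₁.lt _ _ (h₁.symm _ _ hpq)
          have := h _ _ hpq
          split_ifs at this <;> omega
        · omega
        · omega
      · omega
      · exact isNCRel_krewerasRel.refl 0 (by omega)

end Glue

/-! ### Functional equation of the moment series -/

section MomentSeries

theorem isNCRel_empty : IsNCRel 0 fun _ _ => False :=
  ⟨fun a h => absurd h (Nat.not_lt_zero a), fun _ _ h => h.elim, fun _ _ h => h,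
    fun _ _ _ h _ => h, fun _ _ _ _ _ _ _ h _ => h⟩

instance : Unique (NC 0) where
  default := NC.ofRel isNCRel_empty
  uniq γ := NC.rel_injective <| by
    funext a b
    refine propext ⟨fun h => absurd (γ.isNCRel.lt a b h) (Nat.not_lt_zero a), fun h => ?_⟩
    rw [NC.rel_ofRel] at h
    exact h.elim

/-- A sum over the first-point decomposition with the case of an empty second part singled out. -/
theorem sum_NC_succ_eq {M : Type*} [AddCommMonoid M] (n : ℕ) (F : NC (n + 1) → M)
    (P : (m : ℕ) → NC m → M) (Q : (m k : ℕ) → NC m → NC k → M)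
    (hP : ∀ (m : ℕ) (h : m + 0 = n) (γ₁ : NC m) (γ₂ : NC 0), F (NC.join h γ₁ γ₂) = P m γ₁)
    (hQ : ∀ (m k : ℕ) (h : m + (k + 1) = n) (γ₁ : NC m) (γ₂ : NC (k + 1)),
      F (NC.join h γ₁ γ₂) = Q m (k + 1) γ₁ γ₂) :
    ∑ γ, F γ = ∑ γ₁ : NC n, P n γ₁ +
      match (generalizing := false) n with
      | 0 => 0
      | n + 1 => ∑ p ∈ Finset.HasAntidiagonal.antidiagonal n, ∑ γ₁ : NC p.1,
          ∑ γ₂ : NC (p.2 + 1), Q p.1 (p.2 + 1) γ₁ γ₂ := by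
  have h1 : ∀ p : Finset.HasAntidiagonal.antidiagonal n, ∑ γ₁ : NC p.1.1, ∑ γ₂ : NC p.1.2,
      F (NC.join (Finset.HasAntidiagonal.mem_antidiagonal.1 p.2) γ₁ γ₂) =
      (fun q : ℕ × ℕ => if q.2 = 0 then ∑ γ₁ : NC q.1, P q.1 γ₁ else
        ∑ γ₁ : NC q.1, ∑ γ₂ : NC q.2, Q q.1 q.2 γ₁ γ₂) p.1 := by
    rintro ⟨⟨m, k⟩, h⟩
    rw [Finset.HasAntidiagonal.mem_antidiagonal] at h
    cases k with
    | zero => simp [hP]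
    | succ k => simp [hQ]
  rw [sum_NC_succ, Finset.sum_congr rfl fun p _ => h1 p,
    Finset.sum_coe_sort (Finset.HasAntidiagonal.antidiagonal n) (fun q : ℕ × ℕ => if q.2 = 0 then
      ∑ γ₁ : NC q.1, P q.1 γ₁ else ∑ γ₁ : NC q.1, ∑ γ₂ : NC q.2, Q q.1 q.2 γ₁ γ₂)]
  cases n with
  | zero => simp
  | succ n =>
    rw [Finset.Nat.sum_antidiagonal_succ']
    simp

variable {B : Type*} [Ring B] [Algebra ℂ B]

/-- The weight of a non-crossing partition whose interior blocks are weighted by `f` and whose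
exterior blocks are weighted by `g`. -/
def outerWeight (f : ℕ → ℂ) (g : ℕ → B) {n : ℕ} (γ : NC n) : B :=
  (∏ D ∈ γ.intBlocks, f D.card) • (γ.extBlocks.map fun C => g C.card).prod

/-- The moment series `∑ₙ Xⁿ ∑_{γ ∈ NC(n)} ∏_{C ∈ γ} f(|C|)`. -/
def momentSeries (f : ℕ → ℂ) : ℂ⟦X⟧ := PowerSeries.mk fun n => ∑ γ : NC n, ∏ C ∈ γ.blocks, f C.card

/-- The moment series with weights `f` on interior and `g` on exterior blocks. -/
def outerMomentSeries (f : ℕ → ℂ) (g : ℕ → B) : B⟦X⟧ :=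
  PowerSeries.mk fun n => ∑ γ : NC n, outerWeight f g γ

/-- The weight `outerWeight` for a relation, with the size of the first block counted with an
excess `s`. -/
def outerShift (f : ℕ → ℂ) (g : ℕ → B) (s n : ℕ) (r : ℕ → ℕ → Prop) : B :=
  relProd n r (fun a => IsBlockMin r a ∧ IsInner r a) f •
    (g (relSize n r 0 + s) *
      relListProd n r (fun a => (IsBlockMin r a ∧ ¬ IsInner r a) ∧ a ≠ 0) g)

theorem outerWeight_eq (f : ℕ → ℂ) (g : ℕ → B) {n : ℕ} (γ : NC n) :
    outerWeight f g γ = relProd n γ.Rel (fun a => IsBlockMin γ.Rel a ∧ IsInner γ.Rel a) f •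
      relListProd n γ.Rel (fun a => IsBlockMin γ.Rel a ∧ ¬ IsInner γ.Rel a) g := by
  rw [outerWeight, γ.prod_intBlocks, γ.prod_extBlocks]

theorem outerWeight_eq_outerShift (f : ℕ → ℂ) (g : ℕ → B) {n : ℕ} (hn : 0 < n) (γ : NC n) :
    outerWeight f g γ = outerShift f g 0 n γ.Rel := by
  rw [outerWeight_eq, relListProd_outer_eq hn, outerShift, add_zero]

theorem outerShift_join_of_empty (f : ℕ → ℂ) (g : ℕ → B) (s : ℕ) {n m : ℕ} (h : m + 0 = n)
    (γ₁ : NC m) (γ₂ : NC 0) : outerShift f g s (n + 1) (NC.join h γ₁ γ₂).Rel =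
      g (s + 1) * outerWeight f g γ₁ := by
  rw [NC.rel_join, show n + 1 = m + 1 + 0 by omega, outerShift,
    relProd_join_inner_of_empty γ₁.isNCRel γ₂.isNCRel,
    relListProd_join_outer_of_empty γ₁.isNCRel γ₂.isNCRel, relSize_join_zero, outerWeight_eq,
    mul_smul_comm]
  simp [relSize, add_comm]

theorem outerShift_join (f : ℕ → ℂ) (g : ℕ → B) (s : ℕ) {n m k : ℕ} (hk : 0 < k) (h : m + k = n)
    (γ₁ : NC m) (γ₂ : NC k) : outerShift f g s (n + 1) (NC.join h γ₁ γ₂).Rel =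
      (∏ C ∈ γ₁.blocks, f C.card) • outerShift f g (s + 1) k γ₂.Rel := by
  rw [NC.rel_join, show n + 1 = m + 1 + k by omega, outerShift,
    relProd_join_inner γ₁.isNCRel γ₂.isNCRel hk,
    relListProd_join_outer γ₁.isNCRel γ₂.isNCRel hk, relSize_join_zero, outerShift, smul_smul,
    NC.prod_blocks_min]
  simp only [add_assoc, add_comm 1]

/-- The functional equation of the moment series: the block of the first point encloses copies of
the scalar moment series between its elements, and an arbitrary partition follows it. -/
theorem shift_outerMomentSeries (f : ℕ → ℂ) (g : ℕ → B) :
    shift (outerMomentSeries f g) = sub (X * momentSeries f) (PowerSeries.mk fun n => g (n + 1)) *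
      outerMomentSeries f g := by
  have h := eq_sub_mul (g := X * momentSeries f) (by simp)
    (F := fun s => PowerSeries.mk fun n => ∑ γ : NC (n + 1), outerShift f g s (n + 1) γ.Rel)
    (b := fun s => g (s + 1)) (Z := outerMomentSeries f g) ?_
  · rw [← h]
    ext n
    rw [coeff_shift, outerMomentSeries, coeff_mk, coeff_mk]
    exact Finset.sum_congr rfl fun γ _ => outerWeight_eq_outerShift f g n.succ_pos γ
  · intro s
    ext n
    rw [coeff_mk, sum_NC_succ_eq n _ (fun m γ₁ => g (s + 1) * outerWeight f g γ₁)
      (fun m k γ₁ γ₂ => (∏ C ∈ γ₁.blocks, f C.card) • outerShift f g (s + 1) k γ₂.Rel)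
      (fun m h γ₁ γ₂ => outerShift_join_of_empty f g s h γ₁ γ₂)
      (fun m k h γ₁ γ₂ => outerShift_join f g s k.succ_pos h γ₁ γ₂), map_add, coeff_C_mul,
      outerMomentSeries, coeff_mk, Finset.mul_sum]
    congr 1
    cases n with
    | zero => simp
    | succ n =>
      rw [map_mul (scal B), scal_X, mul_assoc, coeff_succ_X_mul, coeff_scal_mul]
      refine Finset.sum_congr rfl fun p _ => ?_
      rw [momentSeries, coeff_mk, coeff_mk, Finset.sum_smul_sum]

/-- The scalar case: equal weights on interior and exterior blocks. -/
theorem outerMomentSeries_self (f : ℕ → ℂ) : outerMomentSeries f f = momentSeries f := by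
  ext n
  rw [outerMomentSeries, momentSeries, coeff_mk, coeff_mk]
  exact Finset.sum_congr rfl fun γ _ => γ.prod_blocks_eq f |>.symm

variable {A : Type*} [Ring A] [Algebra ℂ A]

/-- The series `∑ₙ Zⁿ Xⁿ`. -/
def powSeries (Z : A) : A⟦X⟧ := PowerSeries.mk fun n => Z ^ n

theorem mapLin_powSeries_eq_momentSeries {φ : A →ₗ[ℂ] ℂ} (hφ : φ 1 = 1) (Z : A) :
    mapLin φ (powSeries Z) = momentSeries fun k => freeCumulantOne φ k Z := by
  ext n
  rw [coeff_mapLin, powSeries, coeff_mk, momentSeries, coeff_mk]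
  rcases Nat.eq_zero_or_pos n with rfl | hn
  · rw [Fintype.sum_unique, NC.prod_blocks_min _ fun k => freeCumulantOne φ k Z]
    simp [hφ, relProd]
  · have := moment_eq_sum_freeCumulant φ hn fun _ => Z
    rw [List.ofFn_const, List.prod_replicate] at this
    exact this

theorem mapLin_powSeries_eq_outerMomentSeries {Φ : A →ₗ[ℂ] B} (hΦ : Φ 1 = 1) (φ : A →ₗ[ℂ] ℂ)
    (Z : A) : mapLin Φ (powSeries Z) =
      outerMomentSeries (fun k => freeCumulantOne φ k Z) fun k => cFreeCumulantOne Φ φ k Z := by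
  ext n
  rw [coeff_mapLin, powSeries, coeff_mk, outerMomentSeries, coeff_mk]
  rcases Nat.eq_zero_or_pos n with rfl | hn
  · simp [hΦ, outerWeight_eq, relProd, relListProd]
  · have := moment_eq_sum_cFreeCumulant Φ φ hn fun _ => Z
    rw [List.ofFn_const, List.prod_replicate] at this
    exact this

end MomentSeries

/-! ### Generating functions of sums over Kreweras complements -/

section KrewerasSeries

variable {B : Type*} [Ring B] [Algebra ℂ B]

/-- The part of the Kreweras complement weight that does not involve the block of the last point:
`∏ β(|D|)` over the blocks `D` of `Kr γ` other than that of the last point. -/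
def lastRest (β : ℕ → ℂ) {n : ℕ} (γ : NC n) : ℂ :=
  relProd n (Kr γ).Rel (fun a => IsBlockMax (Kr γ).Rel a ∧ a + 1 ≠ n) β

/-- The size of the block of the last point in the Kreweras complement; it is `0` for
`n = 0`. -/
def lastSize {n : ℕ} (γ : NC n) : ℕ := relSize n (Kr γ).Rel (n - 1)

/-- `∏ α(|C|)` over the blocks `C` of `γ` other than that of the first point. -/
def firstRest (α : ℕ → ℂ) {n : ℕ} (γ : NC n) : ℂ :=
  relProd n γ.Rel (fun a => IsBlockMin γ.Rel a ∧ a ≠ 0) α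

/-- The size of the block of the first point; it is `0` for `n = 0`. -/
def firstSize {n : ℕ} (γ : NC n) : ℕ := relSize n γ.Rel 0

theorem NC.rel_Kr_join {n m k : ℕ} (h : m + k = n) (γ₁ : NC m) (γ₂ : NC k) :
    (Kr (NC.join h γ₁ γ₂)).Rel = glueRel m (Kr γ₁).Rel (Kr γ₂).Rel := by
  rw [NC.rel_Kr, NC.rel_join, show n + 1 = m + 1 + k by omega,
    krewerasRel_joinRel γ₁.isNCRel γ₂.isNCRel, ← NC.rel_Kr, ← NC.rel_Kr]

variable {n m k : ℕ}

theorem firstSize_join (h : m + k = n) (γ₁ : NC m) (γ₂ : NC k) :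
    firstSize (NC.join h γ₁ γ₂) = firstSize γ₂ + 1 := by
  rw [firstSize, NC.rel_join, show n + 1 = m + 1 + k by omega, relSize_join_zero, firstSize]

theorem firstRest_join (α : ℕ → ℂ) (h : m + k = n) (γ₁ : NC m) (γ₂ : NC k) :
    firstRest α (NC.join h γ₁ γ₂) = (∏ C ∈ γ₁.blocks, α C.card) * firstRest α γ₂ := by
  rw [firstRest, NC.rel_join, show n + 1 = m + 1 + k by omega,
    relProd_join_min γ₁.isNCRel γ₂.isNCRel, firstRest, NC.prod_blocks_min]

theorem lastSize_join_of_empty (h : m + 0 = n) (γ₁ : NC m) (γ₂ : NC 0) :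
    lastSize (NC.join h γ₁ γ₂) = lastSize γ₁ + 1 := by
  rw [lastSize, NC.rel_Kr_join, show n + 1 = m + 1 + 0 by omega, show m + 1 + 0 - 1 = m by omega,
    relSize_glue_last (Kr γ₁).isNCRel, lastSize]

theorem lastSize_join (hk : 0 < k) (h : m + k = n) (γ₁ : NC m) (γ₂ : NC k) :
    lastSize (NC.join h γ₁ γ₂) = lastSize γ₂ := by
  rw [lastSize, NC.rel_Kr_join, show n + 1 = m + 1 + k by omega,
    show m + 1 + k - 1 = (k - 1) + (m + 1) by omega, relSize_glue_right, lastSize]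

theorem lastRest_join_of_empty (β : ℕ → ℂ) (h : m + 0 = n) (γ₁ : NC m) (γ₂ : NC 0) :
    lastRest β (NC.join h γ₁ γ₂) = lastRest β γ₁ := by
  rw [lastRest, NC.rel_Kr_join, show n + 1 = m + 1 + 0 by omega,
    relProd_glue_of_empty (Kr γ₁).isNCRel, lastRest]

theorem lastRest_join (β : ℕ → ℂ) (hk : 0 < k) (h : m + k = n) (γ₁ : NC m) (γ₂ : NC k) :
    lastRest β (NC.join h γ₁ γ₂) = lastRest β γ₁ * β (lastSize γ₁ + 1) * lastRest β γ₂ := by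
  rw [lastRest, NC.rel_Kr_join, show n + 1 = m + 1 + k by omega,
    relProd_glue (Kr γ₁).isNCRel hk, lastRest, lastRest, lastSize]

/-- `∑ₙ Xⁿ ∑_{γ ∈ NC(n)} ∏_{C ∈ γ} α(|C|) ∏_{D ∈ Kr(γ)} β(|D|)`, where the block of the last point
of `Kr(γ)` is weighted by `b` instead of `β`, and its size is counted with an excess `r`. -/
def lastSeries (α β : ℕ → ℂ) (b : ℕ → B) (r : ℕ) : B⟦X⟧ :=
  PowerSeries.mk fun n => ∑ γ : NC n,
    ((∏ C ∈ γ.blocks, α C.card) * lastRest β γ) • b (lastSize γ + r)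

/-- The sum over `NC(n + 1)` as in `lastSeries`, where in addition the block of the first point
of `γ` is weighted by `a` and its size is counted with an excess `s`. -/
def firstLastSeries (α β : ℕ → ℂ) (a b : ℕ → B) (s r : ℕ) : B⟦X⟧ :=
  PowerSeries.mk fun n => ∑ γ : NC (n + 1),
    (firstRest α γ * lastRest β γ) • (a (firstSize γ + s) * b (lastSize γ + r))

/-- The scalar series enumerating what lies between two consecutive elements of a block of `γ`. -/
def gapSeries (α β : ℕ → ℂ) : ℂ⟦X⟧ := X * lastSeries α β β 1

/-- The scalar series enumerating what lies between two consecutive elements of a block of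
`Kr(γ)`. -/
def coGapSeries (α β : ℕ → ℂ) : ℂ⟦X⟧ :=
  X * sub (gapSeries α β) (PowerSeries.mk fun n => α (n + 1))

theorem constantCoeff_gapSeries (α β : ℕ → ℂ) : constantCoeff (gapSeries α β) = 0 := by
  simp [gapSeries]

theorem constantCoeff_coGapSeries (α β : ℕ → ℂ) : constantCoeff (coGapSeries α β) = 0 := by
  simp [coGapSeries]

/-- The block of the first point of `γ` is solved for: each of its elements but the last is followed
by a gap. -/
theorem firstLastSeries_eq (α β : ℕ → ℂ) (a b : ℕ → B) (r : ℕ) :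
    firstLastSeries α β a b 0 r =
      sub (gapSeries α β) (PowerSeries.mk fun n => a (n + 1)) * lastSeries α β b (r + 1) := by
  refine eq_sub_mul (constantCoeff_gapSeries α β) (F := fun s => firstLastSeries α β a b s r)
    (b := fun s => a (s + 1)) (Z := lastSeries α β b (r + 1)) fun s => ?_
  ext n
  rw [firstLastSeries, coeff_mk, sum_NC_succ_eq n _
    (fun m γ₁ => a (s + 1) * ((∏ C ∈ γ₁.blocks, α C.card) * lastRest β γ₁) •
      b (lastSize γ₁ + (r + 1)))
    (fun m k γ₁ γ₂ => (((∏ C ∈ γ₁.blocks, α C.card) * lastRest β γ₁) • β (lastSize γ₁ + 1)) •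
      (firstRest α γ₂ * lastRest β γ₂) • (a (firstSize γ₂ + (s + 1)) * b (lastSize γ₂ + r)))
    ?_ ?_, map_add, coeff_C_mul, lastSeries, coeff_mk, Finset.mul_sum]
  · congr 1
    cases n with
    | zero => simp [gapSeries]
    | succ n =>
      rw [gapSeries, map_mul (scal B), scal_X, mul_assoc, coeff_succ_X_mul, coeff_scal_mul]
      refine Finset.sum_congr rfl fun p _ => ?_
      rw [lastSeries, coeff_mk, firstLastSeries, coeff_mk, Finset.sum_smul_sum]
  · intro m h γ₁ γ₂
    rw [firstSize_join, firstRest_join, lastSize_join_of_empty, lastRest_join_of_empty,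
      mul_smul_comm, add_right_comm, add_assoc (lastSize γ₁)]
    simp [firstRest, firstSize, relProd, relSize, add_comm]
  · intro m k h γ₁ γ₂
    rw [firstSize_join, firstRest_join, lastSize_join k.succ_pos, lastRest_join β k.succ_pos,
      smul_smul, add_assoc, add_comm 1 s]
    congr 1
    rw [smul_eq_mul]
    ring

/-- The block of the last point of `Kr γ` is solved for, by applying `firstLastSeries_eq` with the
scalar weights of the block of the first point of `γ`. -/
theorem lastSeries_eq (α β : ℕ → ℂ) (b : ℕ → B) :
    lastSeries α β b 1 = sub (coGapSeries α β) (PowerSeries.mk fun n => b (n + 1)) := by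
  rw [← mul_one (sub _ _)]
  refine eq_sub_mul (constantCoeff_coGapSeries α β) (F := fun s => lastSeries α β b (s + 1))
    (b := fun s => b (s + 1)) (Z := 1) fun s => ?_
  have h := firstLastSeries_eq α β (fun k => algebraMap ℂ B (α k)) b (s + 1)
  have hm : (PowerSeries.mk fun n => algebraMap ℂ B (α (n + 1))) =
      scal B (PowerSeries.mk fun n => α (n + 1)) := by
    ext n; simp [scal]
  rw [hm, ← scal_sub] at h
  rw [coGapSeries, map_mul, scal_X, mul_assoc, ← h, mul_one]
  ext n
  cases n with
  | zero =>
    simp [lastSeries, NC.prod_blocks_min, relProd, lastRest, lastSize, relSize]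
  | succ n =>
    rw [map_add, coeff_succ_X_mul, firstLastSeries, lastSeries, coeff_mk, coeff_mk, coeff_C,
      if_neg n.succ_ne_zero, zero_add]
    refine Finset.sum_congr rfl fun γ _ => ?_
    rw [NC.prod_blocks_min, relProd_min_eq n.succ_pos, ← Algebra.smul_def, smul_smul, firstRest,
      firstSize, add_zero]
    congr 1
    ring

theorem gapSeries_eq (α β : ℕ → ℂ) :
    gapSeries α β = X * sub (coGapSeries α β) (PowerSeries.mk fun n => β (n + 1)) := by
  rw [gapSeries, lastSeries_eq]

/-- The generating function of the right-hand side of the product formula for c-free cumulants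
splits as a product. -/
theorem krewerasSum_eq (α β : ℕ → ℂ) (a b : ℕ → B) (n : ℕ) (hn : 0 < n) :
    ∑ γ : NC n, ((∏ C ∈ γ.blocks.erase (γ.block ⟨0, hn⟩), α C.card) *
        ∏ D ∈ (Kr γ).blocks.erase ((Kr γ).block ⟨n - 1, Nat.sub_one_lt_of_lt hn⟩), β D.card) •
        (a (γ.block ⟨0, hn⟩).card *
          b ((Kr γ).block ⟨n - 1, Nat.sub_one_lt_of_lt hn⟩).card) =
      coeff (n - 1) (sub (gapSeries α β) (PowerSeries.mk fun n => a (n + 1)) *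
        sub (coGapSeries α β) (PowerSeries.mk fun n => b (n + 1))) := by
  obtain ⟨n, rfl⟩ : ∃ k, n = k + 1 := ⟨n - 1, by omega⟩
  rw [← lastSeries_eq, ← firstLastSeries_eq, firstLastSeries]
  change _ = coeff n _
  rw [coeff_mk]
  refine Finset.sum_congr rfl fun γ _ => ?_
  rw [NC.prod_blocks_erase_first, NC.prod_blocks_erase_last, NC.card_block, NC.card_block]
  rfl

theorem krewerasSum_scalar_eq (α β : ℕ → ℂ) (n : ℕ) (hn : 0 < n) :
    ∑ γ : NC n, (∏ C ∈ γ.blocks, α C.card) * ∏ D ∈ (Kr γ).blocks, β D.card =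
      coeff (n - 1) (sub (gapSeries α β) (PowerSeries.mk fun n => α (n + 1)) *
        sub (coGapSeries α β) (PowerSeries.mk fun n => β (n + 1))) := by
  rw [← krewerasSum_eq α β α β n hn]
  refine Finset.sum_congr rfl fun γ _ => ?_
  rw [← Finset.mul_prod_erase _ _ (γ.block_mem ⟨0, hn⟩),
    ← Finset.mul_prod_erase _ _ ((Kr γ).block_mem ⟨n - 1, Nat.sub_one_lt_of_lt hn⟩), smul_eq_mul]
  ring

end KrewerasSeries

/-! ### Resolvents and their moments -/

section Resolvents

variable {A B : Type*} [Ring A] [Algebra ℂ A] [Ring B] [Algebra ℂ B]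

theorem sub_X_left (F : B⟦X⟧) : sub X F = F := by
  ext n
  simp [sub, coeff_X_pow]

/-- A right inverse of `1 - y G` is also a left inverse if `y` has no constant term. -/
theorem mul_one_sub_eq_one {y : ℂ⟦X⟧} (hy : constantCoeff y = 0) {G H : B⟦X⟧}
    (h : (1 - scal B y * G) * H = 1) : H * (1 - scal B y * G) = 1 := by
  set D := H * (1 - scal B y * G) - 1 with hD
  have h1 : D = scal B y * (G * D) := by
    have : (1 - scal B y * G) * D = 0 := by
      rw [hD, mul_sub, ← mul_assoc, h]
      simp
    rw [_root_.sub_mul, one_mul, sub_eq_zero, mul_assoc] at this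
    exact this
  have h2 := eq_zero_of_forall_eq_mul_succ hy (D := fun s => G ^ s * D) (fun s => by
    rw [pow_succ, mul_assoc, ← mul_assoc (scal B y), scal_commute, mul_assoc, ← h1]) 0
  rw [pow_zero, one_mul] at h2
  exact sub_eq_zero.1 h2

/-- The resolvent `(1 - x Z)⁻¹ = ∑ₙ xⁿ Zⁿ` of `Z` at a scalar power series `x`. -/
def resolvent (x : ℂ⟦X⟧) (Z : A) : A⟦X⟧ := sub x (powSeries Z)

theorem resolvent_eq {x : ℂ⟦X⟧} (hx : constantCoeff x = 0) (Z : A) :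
    resolvent x Z = 1 + scal A x * (C Z * resolvent x Z) := by
  have h : shift (powSeries Z) = C Z * powSeries Z := by
    ext n
    simp [powSeries, coeff_C_mul, pow_succ']
  conv_lhs => rw [resolvent, sub_eq hx, h, sub_mul hx, sub_C hx]
  simp [powSeries, resolvent]

theorem one_sub_mul_resolvent {x : ℂ⟦X⟧} (hx : constantCoeff x = 0) (Z : A) :
    (1 - scal A x * C Z) * resolvent x Z = 1 := by
  rw [_root_.sub_mul, one_mul, mul_assoc, sub_eq_iff_eq_add]
  exact resolvent_eq hx Z

theorem resolvent_mul_one_sub {x : ℂ⟦X⟧} (hx : constantCoeff x = 0) (Z : A) :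
    resolvent x Z * (1 - scal A x * C Z) = 1 :=
  mul_one_sub_eq_one hx (one_sub_mul_resolvent hx Z)

/-- The generating series of the free cumulants, `∑ₙ κₙ₊₁(Z) Xⁿ`. -/
def freeCumulantSeries (φ : A →ₗ[ℂ] ℂ) (Z : A) : ℂ⟦X⟧ :=
  PowerSeries.mk fun n => freeCumulantOne φ (n + 1) Z

/-- The generating series of the c-free cumulants, `∑ₙ ᶜκₙ₊₁(Z) Xⁿ`. -/
def cFreeCumulantSeries (Φ : A →ₗ[ℂ] B) (φ : A →ₗ[ℂ] ℂ) (Z : A) : B⟦X⟧ :=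
  PowerSeries.mk fun n => cFreeCumulantOne Φ φ (n + 1) Z

theorem mapLin_C_mul_resolvent_eq_sub (Φ : A →ₗ[ℂ] B) {x : ℂ⟦X⟧} (hx : constantCoeff x = 0)
    (Z : A) :
    mapLin Φ (C Z * resolvent x Z) = sub x (shift (mapLin Φ (powSeries Z))) := by
  have h : C Z * powSeries Z = shift (powSeries Z) := by
    ext n
    simp [powSeries, coeff_C_mul, pow_succ']
  rw [resolvent, ← sub_C hx, ← sub_mul hx, h, mapLin_subst]
  congr 1
  ext n
  simp

/-- The functional equation for the free cumulants, evaluated at a scalar power series. -/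
theorem mapLin_C_mul_resolvent_scalar {φ : A →ₗ[ℂ] ℂ} (hφ : φ 1 = 1) {x : ℂ⟦X⟧}
    (hx : constantCoeff x = 0) (Z : A) : mapLin φ (C Z * resolvent x Z) =
      sub (x * mapLin φ (resolvent x Z)) (freeCumulantSeries φ Z) * mapLin φ (resolvent x Z) := by
  rw [mapLin_C_mul_resolvent_eq_sub φ hx, mapLin_powSeries_eq_momentSeries hφ,
    ← outerMomentSeries_self, shift_outerMomentSeries, outerMomentSeries_self, sub_mul hx,
    sub_sub_eq hx (by simp), sub_mul hx, sub_X hx, scal_self,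
    ← mapLin_powSeries_eq_momentSeries hφ, ← mapLin_subst]
  rfl

/-- The functional equation for the c-free cumulants, evaluated at a scalar power series. -/
theorem mapLin_C_mul_resolvent {φ : A →ₗ[ℂ] ℂ} (hφ : φ 1 = 1) {Φ : A →ₗ[ℂ] B} (hΦ : Φ 1 = 1)
    {x : ℂ⟦X⟧} (hx : constantCoeff x = 0) (Z : A) : mapLin Φ (C Z * resolvent x Z) =
      sub (x * mapLin φ (resolvent x Z)) (cFreeCumulantSeries Φ φ Z) *
        mapLin Φ (resolvent x Z) := by
  rw [mapLin_C_mul_resolvent_eq_sub Φ hx, mapLin_powSeries_eq_outerMomentSeries hΦ φ,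
    shift_outerMomentSeries, sub_mul hx, sub_sub_eq hx (by simp), sub_mul hx, sub_X hx, scal_self,
    ← mapLin_powSeries_eq_momentSeries hφ, ← mapLin_powSeries_eq_outerMomentSeries hΦ φ,
    ← mapLin_subst, ← mapLin_subst]
  rfl

theorem mapLin_one {Φ : A →ₗ[ℂ] B} (hΦ : Φ 1 = 1) : mapLin Φ (1 : A⟦X⟧) = 1 := by
  simpa using mapLin_scal hΦ 1

theorem mapLin_resolvent_eq {Φ : A →ₗ[ℂ] B} (hΦ : Φ 1 = 1) {x : ℂ⟦X⟧} (hx : constantCoeff x = 0)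
    (Z : A) : mapLin Φ (resolvent x Z) = 1 + scal B x * mapLin Φ (C Z * resolvent x Z) := by
  conv_lhs => rw [resolvent_eq hx, mapLin_add, mapLin_one hΦ, mapLin_scal_mul]

/-- The scalar moment series of `Z` is recognised by its functional equation. -/
theorem mapLin_resolvent_eq_of_functional_equation {φ : A →ₗ[ℂ] ℂ} (hφ : φ 1 = 1) {x N : ℂ⟦X⟧}
    (hx : constantCoeff x = 0) (Z : A) (hN : N = 1 + x * N * sub (x * N) (freeCumulantSeries φ Z)) :
    mapLin φ (resolvent x Z) = N := by
  refine eq_of_functional_equation (c := freeCumulantSeries φ Z) hx ?_ hN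
  conv_lhs => rw [mapLin_resolvent_eq hφ hx, mapLin_C_mul_resolvent_scalar hφ hx, scal_self]
  ring

end Resolvents

/-! ### The factorization of the resolvent of a product -/

section Factorization

/-- The factorization behind the product formulas: with `R = (1 - x a)⁻¹`, `S = (1 - y b)⁻¹` and
scalars related as stated, `1 - z a b` is, up to the factor `N⁻¹ = M`, the product of `1 - x a`,
`1 - y b` and an alternating expression in `R` and `S`. -/
theorem one_sub_mul_factorization {S E : Type*} [CommRing S] [Ring E] [Algebra S E]
    {N M t x y z u₁ v₁ : S} (hN : N = 1 + t * u₁ * v₁) (hM : N * M = 1) (hz : z = t * M)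
    (hx : x = z * v₁) (hy : y = z * u₁) {a b r s : E} (hr : (1 - x • a) * r = 1)
    (hs : s * (1 - y • b) = 1) :
    (1 - x • a) * (1 - z • ((M • (a * r) - u₁ • 1) * (M • (b * s) - v₁ • 1))) * (1 - y • b) =
      M • (1 - z • (a * b)) := by
  have hM' : M + x * u₁ = 1 := by
    rw [hx, hz]; linear_combination hM - M * hN
  have hM'' : M + y * v₁ = 1 := by
    rw [hy, hz]; linear_combination hM - M * hN
  have h1 : (1 - x • a) * (M • (a * r) - u₁ • 1) = a - u₁ • 1 := by
    have : (1 - x • a) * (a * r) = a := by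
      calc (1 - x • a) * (a * r) = a * ((1 - x • a) * r) := by
            simp only [_root_.sub_mul, mul_sub, one_mul, smul_mul_assoc, mul_smul_comm]
        _ = a := by rw [hr, mul_one]
    rw [mul_sub, mul_smul_comm, this, mul_smul_comm, mul_one]
    calc M • a - u₁ • (1 - x • a) = (M + x * u₁) • a - u₁ • (1 : E) := by module
      _ = _ := by rw [hM', one_smul]
  have h2 : (M • (b * s) - v₁ • 1) * (1 - y • b) = b - v₁ • 1 := by
    rw [_root_.sub_mul, smul_mul_assoc, mul_assoc, hs, mul_one, smul_mul_assoc, one_mul]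
    calc M • b - v₁ • (1 - y • b) = (M + y * v₁) • b - v₁ • (1 : E) := by module
      _ = _ := by rw [hM'', one_smul]
  calc _ = (1 - x • a) * (1 - y • b) - z • (((1 - x • a) * (M • (a * r) - u₁ • 1)) *
        ((M • (b * s) - v₁ • 1) * (1 - y • b))) := by
        simp only [mul_sub, _root_.sub_mul, mul_one, one_mul, smul_mul_assoc, mul_smul_comm,
          mul_assoc, smul_sub]
        module
    _ = (1 - x • a) * (1 - y • b) - z • ((a - u₁ • 1) * (b - v₁ • 1)) := by rw [h1, h2]
    _ = (1 - z * u₁ * v₁) • (1 : E) + (z * v₁ - x) • a + (z * u₁ - y) • b +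
          (x * y - z) • (a * b) := by
        simp only [mul_sub, _root_.sub_mul, mul_one, one_mul, smul_mul_assoc, mul_smul_comm]
        module
    _ = _ := by
        have e1 : 1 - z * u₁ * v₁ = M := by
          rw [hz]; linear_combination -hM + M * hN
        have e2 : x * y - z = - (M * z) := by
          rw [hx, hy]; linear_combination - z * e1
        rw [e1, e2, ← hx, ← hy, sub_self, sub_self]
        module

/-- The factorization for power series over a complex algebra. -/
theorem one_sub_scal_mul_factorization {E : Type*} [Ring E] [Algebra ℂ E]
    {N M t x y z u₁ v₁ : ℂ⟦X⟧} (hN : N = 1 + t * u₁ * v₁) (hM : N * M = 1) (hz : z = t * M)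
    (hx : x = z * v₁) (hy : y = z * u₁) {a b r s : E⟦X⟧} (hr : (1 - scal E x * a) * r = 1)
    (hs : s * (1 - scal E y * b) = 1) :
    (1 - scal E x * a) * (1 - scal E z * ((scal E M * (a * r) - scal E u₁) *
      (scal E M * (b * s) - scal E v₁))) * (1 - scal E y * b) =
      scal E M * (1 - scal E z * (a * b)) := by
  -- for `E = ℂ` this is a second instance, which is why it is kept local
  let _ : Algebra ℂ⟦X⟧ E⟦X⟧ := (scal E).toAlgebra' scal_commute
  have hsm : ∀ (c : ℂ⟦X⟧) (e : E⟦X⟧), c • e = scal E c * e := fun _ _ => rfl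
  have := one_sub_mul_factorization (E := E⟦X⟧) hN hM hz hx hy (a := a) (b := b) (r := r) (s := s)
    (by rwa [hsm]) (by rwa [hsm])
  simpa only [hsm, mul_one] using this

end Factorization

/-! ### Alternating products of centred power series -/

section Alternating

variable {A B : Type*} [Ring A] [Algebra ℂ A] [Ring B] [Algebra ℂ B]

/-- The `φ`-centred elements of a subalgebra. -/
def centred (φ : A →ₗ[ℂ] ℂ) (A₁ : Subalgebra ℂ A) : Submodule ℂ A :=
  Subalgebra.toSubmodule A₁ ⊓ LinearMap.ker φ

theorem mem_centred {φ : A →ₗ[ℂ] ℂ} {A₁ : Subalgebra ℂ A} {a : A} :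
    a ∈ centred φ A₁ ↔ a ∈ A₁ ∧ φ a = 0 := by simp [centred]

/-- The linear span of the alternating products `a_1 ⋯ a_n` (`n ≥ 1`) of centred elements
of the two subalgebras for which `a_1` lies in the subalgebra of index `i`. -/
def altSpan (φ : A →ₗ[ℂ] ℂ) (A' : Fin 2 → Subalgebra ℂ A) (i : Fin 2) : Submodule ℂ A :=
  Submodule.span ℂ {w | ∃ (n : ℕ) (ε : Fin (n + 1) → Fin 2) (a : Fin (n + 1) → A),
    (∀ j, φ (a j) = 0) ∧ (∀ j, a j ∈ A' (ε j)) ∧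
    (∀ (j : ℕ) (h : j + 1 < n + 1), ε ⟨j, by omega⟩ ≠ ε ⟨j + 1, h⟩) ∧ ε 0 = i ∧
    (List.ofFn a).prod = w}

variable {φ : A →ₗ[ℂ] ℂ} {Φ : A →ₗ[ℂ] B} {A' : Fin 2 → Subalgebra ℂ A}

theorem centred_le_altSpan (i : Fin 2) : centred φ (A' i) ≤ altSpan φ A' i := by
  intro a ha
  rw [mem_centred] at ha
  refine Submodule.subset_span ⟨0, fun _ => i, fun _ => a, fun _ => ha.2, fun _ => ha.1, ?_, rfl,
    ?_⟩
  · intro j h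
    omega
  · simp

/-- The condition of c-freeness for a pair of subalgebras given as a family. -/
def CFreeFamily (Φ : A →ₗ[ℂ] B) (φ : A →ₗ[ℂ] ℂ) (A' : Fin 2 → Subalgebra ℂ A) : Prop :=
  SubalgebrasCFree Φ φ (A' 0) (A' 1)

theorem CFreeFamily.apply (h : CFreeFamily Φ φ A') {n : ℕ} (ε : Fin (n + 1) → Fin 2)
    (a : Fin (n + 1) → A) (h₁ : ∀ j, φ (a j) = 0) (h₂ : ∀ j, a j ∈ A' (ε j))
    (h₃ : ∀ (j : ℕ) (h : j + 1 < n + 1), ε ⟨j, by omega⟩ ≠ ε ⟨j + 1, h⟩) :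
    φ (List.ofFn a).prod = 0 ∧ Φ (List.ofFn a).prod = (List.ofFn fun j => Φ (a j)).prod := by
  refine h (n + 1) n.succ_pos ε a h₁ (fun j => ?_) h₃
  have : (![A' 0, A' 1] : Fin 2 → Subalgebra ℂ A) = A' := by
    funext i
    fin_cases i <;> rfl
  rw [this]
  exact h₂ j

theorem CFreeFamily.map_eq_zero (h : CFreeFamily Φ φ A') {i : Fin 2} {w : A}
    (hw : w ∈ altSpan φ A' i) : φ w = 0 := by
  suffices altSpan φ A' i ≤ LinearMap.ker φ from LinearMap.mem_ker.1 (this hw)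
  refine Submodule.span_le.2 ?_
  rintro _ ⟨n, ε, a, h₁, h₂, h₃, -, rfl⟩
  exact (h.apply ε a h₁ h₂ h₃).1

/-- Multiplication by a centred element of the other subalgebra keeps a product alternating, and `Φ`
is multiplicative on such products. -/
theorem CFreeFamily.mul_mem (h : CFreeFamily Φ φ A') {i j : Fin 2} (hij : j ≠ i) {a w : A}
    (ha : a ∈ centred φ (A' j)) (hw : w ∈ altSpan φ A' i) :
    a * w ∈ altSpan φ A' j ∧ Φ (a * w) = Φ a * Φ w := by
  rw [mem_centred] at ha
  suffices altSpan φ A' i ≤ (altSpan φ A' j).comap (LinearMap.mulLeft ℂ a) ⊓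
      LinearMap.ker (Φ ∘ₗ LinearMap.mulLeft ℂ a - LinearMap.mulLeft ℂ (Φ a) ∘ₗ Φ) by
    simpa [sub_eq_zero] using this hw
  refine Submodule.span_le.2 ?_
  rintro _ ⟨n, ε, c, h₁, h₂, h₃, hi, rfl⟩
  have e : a * (List.ofFn c).prod = (List.ofFn (Fin.cons a c : Fin (n + 2) → A)).prod := by
    rw [List.ofFn_succ (f := (Fin.cons a c : Fin (n + 2) → A)), List.prod_cons]
    simp
  have k₁ : ∀ l, φ ((Fin.cons a c : Fin (n + 2) → A) l) = 0 := by
    intro l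
    refine Fin.cases ?_ (fun l => ?_) l
    · simpa using ha.2
    · simpa using h₁ l
  have k₂ : ∀ l, (Fin.cons a c : Fin (n + 2) → A) l ∈
      A' ((Fin.cons j ε : Fin (n + 2) → Fin 2) l) := by
    intro l
    refine Fin.cases ?_ (fun l => ?_) l
    · simpa using ha.1
    · simpa using h₂ l
  have k₃ : ∀ (l : ℕ) (h : l + 1 < n + 1 + 1), (Fin.cons j ε : Fin (n + 2) → Fin 2)
      ⟨l, by omega⟩ ≠ (Fin.cons j ε : Fin (n + 2) → Fin 2) ⟨l + 1, h⟩ := by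
    rintro (_ | l) hl
    · change j ≠ ε 0
      rwa [hi]
    · exact h₃ l (by omega)
  have hΦ := (h.apply _ _ k₁ k₂ k₃).2
  have hΦ' := (h.apply ε c h₁ h₂ h₃).2
  refine ⟨?_, ?_⟩
  · exact Submodule.subset_span ⟨n + 1, Fin.cons j ε, Fin.cons a c, k₁, k₂, k₃, rfl, e.symm⟩
  · rw [← e] at hΦ
    rw [SetLike.mem_coe, LinearMap.mem_ker]
    simp only [LinearMap.sub_apply, LinearMap.comp_apply, LinearMap.mulLeft_apply, sub_eq_zero]
    rw [hΦ, hΦ', List.ofFn_succ, List.prod_cons]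
    simp

/-- All coefficients of `F` lie in `S`. -/
def CoeffsIn (S : Submodule ℂ A) (F : A⟦X⟧) : Prop := ∀ n, coeff n F ∈ S

theorem CoeffsIn.add {S : Submodule ℂ A} {F G : A⟦X⟧} (hF : CoeffsIn S F) (hG : CoeffsIn S G) :
    CoeffsIn S (F + G) := fun n => by
  rw [map_add]
  exact S.add_mem (hF n) (hG n)

theorem CoeffsIn.scal_mul {S : Submodule ℂ A} {F : A⟦X⟧} (hF : CoeffsIn S F) (f : ℂ⟦X⟧) :
    CoeffsIn S (scal A f * F) := fun n => by
  rw [coeff_scal_mul]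
  exact S.sum_mem fun p _ => S.smul_mem _ (hF _)

theorem CoeffsIn.mono {S T : Submodule ℂ A} (h : S ≤ T) {F : A⟦X⟧} (hF : CoeffsIn S F) :
    CoeffsIn T F := fun n => h (hF n)

theorem CFreeFamily.mapLin_eq_zero (h : CFreeFamily Φ φ A') {i : Fin 2} {F : A⟦X⟧}
    (hF : CoeffsIn (altSpan φ A' i) F) : mapLin φ F = 0 := by
  ext n
  simp [h.map_eq_zero (hF n)]

theorem CFreeFamily.coeff_mul_mem (h : CFreeFamily Φ φ A') {i j : Fin 2} (hij : j ≠ i)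
    {P F : A⟦X⟧} (hP : CoeffsIn (centred φ (A' j)) P) {n : ℕ}
    (hF : ∀ k ≤ n, coeff k F ∈ altSpan φ A' i) : coeff n (P * F) ∈ altSpan φ A' j := by
  rw [coeff_mul]
  refine Submodule.sum_mem _ fun p hp => ?_
  rw [Finset.HasAntidiagonal.mem_antidiagonal] at hp
  exact (h.mul_mem hij (hP p.1) (hF p.2 (by omega))).1

theorem CFreeFamily.coeffsIn_mul (h : CFreeFamily Φ φ A') {i j : Fin 2} (hij : j ≠ i)
    {P F : A⟦X⟧} (hP : CoeffsIn (centred φ (A' j)) P) (hF : CoeffsIn (altSpan φ A' i) F) :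
    CoeffsIn (altSpan φ A' j) (P * F) :=
  fun _ => h.coeff_mul_mem hij hP fun k _ => hF k

theorem CFreeFamily.mapLin_mul (h : CFreeFamily Φ φ A') {i j : Fin 2} (hij : j ≠ i)
    {P F : A⟦X⟧} (hP : CoeffsIn (centred φ (A' j)) P) (hF : CoeffsIn (altSpan φ A' i) F) :
    mapLin Φ (P * F) = mapLin Φ P * mapLin Φ F := by
  ext n
  rw [coeff_mapLin, coeff_mul, coeff_mul, map_sum]
  refine Finset.sum_congr rfl fun p _ => ?_
  rw [(h.mul_mem hij (hP p.1) (hF p.2)).2, coeff_mapLin, coeff_mapLin]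

theorem mem_centred_of_mapLin_eq_zero {A₁ : Subalgebra ℂ A} {F : A⟦X⟧} (h : mapLin φ F = 0)
    (hF : CoeffsIn (Subalgebra.toSubmodule A₁) F) : CoeffsIn (centred φ A₁) F := fun n => by
  rw [mem_centred]
  refine ⟨hF n, ?_⟩
  rw [← coeff_mapLin, h, map_zero]

theorem coeffsIn_C_mul_resolvent (x : ℂ⟦X⟧) (Z : A) :
    CoeffsIn (Subalgebra.toSubmodule (Algebra.adjoin ℂ {Z})) (C Z * resolvent x Z) := fun n => by
  rw [coeff_C_mul, resolvent, sub, coeff_mk, Finset.mul_sum]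
  have hZ := Algebra.self_mem_adjoin_singleton ℂ Z
  refine Submodule.sum_mem _ fun k _ => ?_
  rw [mul_smul_comm, powSeries, coeff_mk]
  exact Submodule.smul_mem _ _ (Subalgebra.mul_mem _ hZ (Subalgebra.pow_mem _ hZ k))

theorem coeffsIn_scal (A₁ : Subalgebra ℂ A) (f : ℂ⟦X⟧) :
    CoeffsIn (Subalgebra.toSubmodule A₁) (scal A f) := fun n => by
  simp only [scal, coeff_map]
  exact A₁.algebraMap_mem _

/-- The core of the computation: if `V = N + v p + z p q V` and `W' = (N + u q) V`, for centred
series `p` and `q` over the two subalgebras, then `V - N` is a sum of alternating products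
of centred elements starting in the first subalgebra, so that `φ` and `Φ` of `V` and `W'` can be
read off. -/
theorem CFreeFamily.mapLin_alternating (h : CFreeFamily Φ φ A') (hφ : φ 1 = 1) (hΦ : Φ 1 = 1)
    {N u v z : ℂ⟦X⟧} (hz : constantCoeff z = 0) {p q V : A⟦X⟧}
    (hp : CoeffsIn (centred φ (A' 0)) p) (hq : CoeffsIn (centred φ (A' 1)) q)
    (hV : V = scal A N + scal A v * p + scal A z * (p * q) * V) :
    mapLin φ ((scal A N + scal A u * q) * V) = N * N ∧
    mapLin Φ ((scal A N + scal A u * q) * V) = (scal B N + scal B u * mapLin Φ q) * mapLin Φ V ∧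
    mapLin Φ V = scal B N + scal B v * mapLin Φ p +
      scal B z * (mapLin Φ p * mapLin Φ q) * mapLin Φ V := by
  obtain ⟨D, rfl⟩ : ∃ D, V = scal A N + D := ⟨V - scal A N, by abel⟩
  have hq' := hq.mono (centred_le_altSpan 1)
  have hp' := hp.mono (centred_le_altSpan 0)
  have hpq := h.coeffsIn_mul (by decide) hp hq'
  have hD : D = scal A v * p + scal A (z * N) * (p * q) + scal A z * (p * (q * D)) := by
    have e : scal A z * (p * q) * (scal A N + D) =
        scal A (z * N) * (p * q) + scal A z * (p * (q * D)) := by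
      rw [mul_add, mul_assoc _ _ (scal A N), ← scal_commute, ← mul_assoc, ← map_mul]
      simp only [mul_assoc]
    rw [e] at hV
    rw [add_assoc] at hV
    exact (add_left_cancel hV).trans (add_assoc _ _ _).symm
  -- `z` has no constant term, so the equation for `D` determines its coefficients recursively
  have hDm : CoeffsIn (altSpan φ A' 0) D := by
    intro n
    induction n using Nat.strong_induction_on with
    | _ n ih =>
      rw [hD, map_add]
      refine Submodule.add_mem _ (((hp'.scal_mul v).add (hpq.scal_mul (z * N))) n) ?_
      refine coeff_scal_mul_mem hz fun k hk => ?_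
      refine h.coeff_mul_mem (show (0 : Fin 2) ≠ 1 by decide) hp fun l hl => ?_
      exact h.coeff_mul_mem (show (1 : Fin 2) ≠ 0 by decide) hq fun l' hl' => ih l' (by omega)
  have hqD := h.coeffsIn_mul (show (1 : Fin 2) ≠ 0 by decide) hq hDm
  have e : (scal A N + scal A u * q) * (scal A N + D) =
      scal A N * scal A N + scal A N * D + scal A (u * N) * q + scal A u * (q * D) := by
    have : scal A u * q * scal A N = scal A (u * N) * q := by
      rw [mul_assoc, ← scal_commute, ← mul_assoc, ← map_mul]
    rw [add_mul, mul_add, mul_add, this, mul_assoc, add_assoc, add_assoc, add_assoc]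
  refine ⟨?_, ?_, ?_⟩
  · rw [e]
    simp only [mapLin_add, mapLin_scal_mul, mapLin_scal hφ, h.mapLin_eq_zero hDm,
      h.mapLin_eq_zero hq', h.mapLin_eq_zero hqD, mul_zero, add_zero, scal_self]
  · rw [e]
    simp only [mapLin_add, mapLin_scal_mul, mapLin_scal hΦ,
      h.mapLin_mul (show (1 : Fin 2) ≠ 0 by decide) hq hDm]
    have : scal B u * mapLin Φ q * scal B N = scal B (u * N) * mapLin Φ q := by
      rw [mul_assoc, ← scal_commute, ← mul_assoc, ← map_mul]
    rw [add_mul, mul_add, mul_add, this, mul_assoc (scal B u), add_assoc, add_assoc]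
  · have eB : mapLin Φ D = scal B v * mapLin Φ p + scal B (z * N) * (mapLin Φ p * mapLin Φ q) +
        scal B z * (mapLin Φ p * (mapLin Φ q * mapLin Φ D)) := by
      conv_lhs => rw [hD]
      simp only [mapLin_add, mapLin_scal_mul,
        h.mapLin_mul (show (0 : Fin 2) ≠ 1 by decide) hp hq',
        h.mapLin_mul (show (0 : Fin 2) ≠ 1 by decide) hp hqD,
        h.mapLin_mul (show (1 : Fin 2) ≠ 0 by decide) hq hDm]
    have e' : scal B z * (mapLin Φ p * mapLin Φ q) * (scal B N + mapLin Φ D) =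
        scal B (z * N) * (mapLin Φ p * mapLin Φ q) +
          scal B z * (mapLin Φ p * (mapLin Φ q * mapLin Φ D)) := by
      rw [mul_add, mul_assoc _ _ (scal B N), ← scal_commute, ← mul_assoc, ← map_mul]
      simp only [mul_assoc]
    rw [mapLin_add, mapLin_scal hΦ, e', add_assoc, add_right_inj]
    conv_lhs => rw [eB]
    rw [add_assoc]

end Alternating

/-! ### Cumulants of a product of c-free elements -/

section Product

variable {A B : Type*} [Ring A] [Algebra ℂ A] [Ring B] [Algebra ℂ B]

/-- The resolvent as its scalar part `N` plus a multiple of the centred series. -/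
theorem resolvent_eq_scal_add {N M x v u₁ : ℂ⟦X⟧} (hx : constantCoeff x = 0) (h₁ : v * M = x)
    (h₂ : N = 1 + v * u₁) (Z : A) : resolvent x Z =
      scal A N + scal A v * (scal A M * (C Z * resolvent x Z) - scal A u₁) := by
  rw [mul_sub, ← mul_assoc, ← map_mul, ← map_mul, h₁, h₂, map_add, map_one]
  conv_lhs => rw [resolvent_eq hx]
  abel

/-- The cumulant series of a product of c-free elements. -/
theorem cumulantSeries_mul {φ : A →ₗ[ℂ] ℂ} (hφ : φ 1 = 1) {Φ : A →ₗ[ℂ] B} (hΦ : Φ 1 = 1) {a b : A}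
    (h : ElementsCFree Φ φ a b) {u v : ℂ⟦X⟧}
    (hu : u = X * sub v (freeCumulantSeries φ a)) (hv : v = X * sub u (freeCumulantSeries φ b)) :
    freeCumulantSeries φ (a * b) =
      sub v (freeCumulantSeries φ a) * sub u (freeCumulantSeries φ b) ∧
    cFreeCumulantSeries Φ φ (a * b) =
      sub v (cFreeCumulantSeries Φ φ a) * sub u (cFreeCumulantSeries Φ φ b) := by
  obtain ⟨u₁, hu₁⟩ : ∃ u₁, u₁ = sub v (freeCumulantSeries φ a) := ⟨_, rfl⟩
  obtain ⟨v₁, hv₁⟩ : ∃ v₁, v₁ = sub u (freeCumulantSeries φ b) := ⟨_, rfl⟩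
  rw [← hu₁] at hu ⊢
  rw [← hv₁] at hv ⊢
  obtain ⟨N, hN⟩ : ∃ N, N = 1 + X * u₁ * v₁ := ⟨_, rfl⟩
  obtain ⟨M, hM⟩ : ∃ M, N * M = 1 := ⟨N⁻¹, PowerSeries.mul_inv_cancel N (by simp [hN])⟩
  obtain ⟨z, hz⟩ : ∃ z, z = X * M := ⟨_, rfl⟩
  obtain ⟨x, hx⟩ : ∃ x, x = z * v₁ := ⟨_, rfl⟩
  obtain ⟨y, hy⟩ : ∃ y, y = z * u₁ := ⟨_, rfl⟩
  have hz0 : constantCoeff z = 0 := by simp [hz]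
  have hx0 : constantCoeff x = 0 := by simp [hx, hz]
  have hy0 : constantCoeff y = 0 := by simp [hy, hz]
  have hzN : z * N = X := by rw [hz]; linear_combination X * hM
  have hxN : x * N = v := by rw [hx, hv]; linear_combination v₁ * hzN
  have hyN : y * N = u := by rw [hy, hu]; linear_combination u₁ * hzN
  -- the scalar moment series of `a` at `x` and of `b` at `y` both equal `N`
  have ha : mapLin φ (resolvent x a) = N := by
    refine mapLin_resolvent_eq_of_functional_equation hφ hx0 a ?_
    rw [hxN, ← hu₁, hv, hN]; ring
  have hb : mapLin φ (resolvent y b) = N := by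
    refine mapLin_resolvent_eq_of_functional_equation hφ hy0 b ?_
    rw [hyN, ← hv₁, hu, hN]
  have ha' := mapLin_C_mul_resolvent_scalar hφ hx0 a
  have hb' := mapLin_C_mul_resolvent_scalar hφ hy0 b
  rw [ha, hxN, ← hu₁] at ha'
  rw [hb, hyN, ← hv₁] at hb'
  have hΦa := mapLin_C_mul_resolvent hφ hΦ hx0 a
  have hΦb := mapLin_C_mul_resolvent hφ hΦ hy0 b
  rw [ha, hxN] at hΦa
  rw [hb, hyN] at hΦb
  -- the centred series with `R = N + v p` and `S = N + u q`; their definition avoids a division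
  -- by `u` and `v`, which may vanish
  obtain ⟨p, hp⟩ : ∃ p, p = scal A M * (C a * resolvent x a) - scal A u₁ := ⟨_, rfl⟩
  obtain ⟨q, hq⟩ : ∃ q, q = scal A M * (C b * resolvent y b) - scal A v₁ := ⟨_, rfl⟩
  have hfam : CFreeFamily Φ φ ![Algebra.adjoin ℂ {a}, Algebra.adjoin ℂ {b}] := h
  have hp0 : CoeffsIn (centred φ (Algebra.adjoin ℂ {a})) p := by
    refine mem_centred_of_mapLin_eq_zero ?_ ?_
    · rw [hp, mapLin_sub, mapLin_scal_mul, mapLin_scal hφ, ha', scal_self, scal_self]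
      linear_combination u₁ * hM
    · intro n
      rw [hp, map_sub]
      exact Submodule.sub_mem _ ((coeffsIn_C_mul_resolvent x a).scal_mul M n) (coeffsIn_scal _ u₁ n)
  have hq0 : CoeffsIn (centred φ (Algebra.adjoin ℂ {b})) q := by
    refine mem_centred_of_mapLin_eq_zero ?_ ?_
    · rw [hq, mapLin_sub, mapLin_scal_mul, mapLin_scal hφ, hb', scal_self, scal_self]
      linear_combination v₁ * hM
    · intro n
      rw [hq, map_sub]
      exact Submodule.sub_mem _ ((coeffsIn_C_mul_resolvent y b).scal_mul M n) (coeffsIn_scal _ v₁ n)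
  have hRp : resolvent x a = scal A N + scal A v * p := by
    rw [hp]
    exact resolvent_eq_scal_add hx0 (by rw [hv, hx, hz]; ring) (by rw [hv, hN]; ring) a
  have hSq : resolvent y b = scal A N + scal A u * q := by
    rw [hq]
    exact resolvent_eq_scal_add hy0 (by rw [hu, hy, hz]; ring) (by rw [hu, hN]) b
  obtain ⟨W, hW⟩ : ∃ W, W = resolvent z (a * b) := ⟨_, rfl⟩
  -- `V` is `(1 - z p q)⁻¹ R`
  obtain ⟨V, hV⟩ : ∃ V, V = scal A N * ((1 - scal A y * C b) * W) := ⟨_, rfl⟩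
  have hSV : resolvent y b * V = scal A N * W := by
    rw [hV, ← mul_assoc, ← scal_commute, mul_assoc, ← mul_assoc (resolvent y b),
      resolvent_mul_one_sub hy0, one_mul]
  have hfac := one_sub_scal_mul_factorization hN hM hz hx hy (one_sub_mul_resolvent hx0 a)
    (resolvent_mul_one_sub hy0 b)
  rw [← hp, ← hq] at hfac
  have hVeq : V = scal A N + scal A v * p + scal A z * (p * q) * V := by
    rw [← hRp]
    have e : (1 - scal A x * C a) * ((1 - scal A z * (p * q)) * V) = 1 := by
      calc _ = scal A N * (((1 - scal A x * C a) * (1 - scal A z * (p * q)) *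
            (1 - scal A y * C b)) * W) := by
            rw [hV, ← mul_assoc, ← mul_assoc, ← scal_commute]
            simp only [mul_assoc]
        _ = 1 := by
            rw [hfac, hW, ← map_mul, mul_assoc, one_sub_mul_resolvent hz0, mul_one, ← map_mul, hM,
              map_one]
    have e' : (1 - scal A z * (p * q)) * V = resolvent x a := by
      have := congrArg (resolvent x a * ·) e
      simpa only [← mul_assoc, resolvent_mul_one_sub hx0, one_mul, mul_one] using this
    rw [← e']
    noncomm_ring
  obtain ⟨h1, h2, h3⟩ := hfam.mapLin_alternating hφ hΦ (u := u) hz0 hp0 hq0 hVeq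
  rw [← hSq, hSV, mapLin_scal_mul] at h1 h2
  rw [scal_self] at h1
  have hWN : mapLin φ W = N := by
    linear_combination M * h1 - (mapLin φ W - N) * hM
  rw [hW] at hWN
  constructor
  · have e1 := mapLin_resolvent_eq hφ hz0 (a * b)
    rw [mapLin_C_mul_resolvent_scalar hφ hz0, hWN, hzN, sub_X_left, scal_self] at e1
    have e2 : X * freeCumulantSeries φ (a * b) = X * (u₁ * v₁) := by
      linear_combination (-1) * e1 + hN - freeCumulantSeries φ (a * b) * hzN
    exact mul_left_cancel₀ X_ne_zero e2
  · -- the same factorization, now over `B`, with `Φ` of the resolvents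
    set A₁ := sub v (cFreeCumulantSeries Φ φ a) with hA₁
    set B₁ := sub u (cFreeCumulantSeries Φ φ b) with hB₁
    have hma : (1 - scal B x * A₁) * mapLin Φ (resolvent x a) = 1 := by
      rw [_root_.sub_mul, one_mul, mul_assoc, ← hΦa, sub_eq_iff_eq_add]
      exact mapLin_resolvent_eq hΦ hx0 a
    have hmb : (1 - scal B y * B₁) * mapLin Φ (resolvent y b) = 1 := by
      rw [_root_.sub_mul, one_mul, mul_assoc, ← hΦb, sub_eq_iff_eq_add]
      exact mapLin_resolvent_eq hΦ hy0 b
    have hmb' := mul_one_sub_eq_one hy0 hmb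
    have hpB : mapLin Φ p = scal B M * (A₁ * mapLin Φ (resolvent x a)) - scal B u₁ := by
      rw [hp, mapLin_sub, mapLin_scal_mul, mapLin_scal hΦ, hΦa]
    have hqB : mapLin Φ q = scal B M * (B₁ * mapLin Φ (resolvent y b)) - scal B v₁ := by
      rw [hq, mapLin_sub, mapLin_scal_mul, mapLin_scal hΦ, hΦb]
    have hfacB := one_sub_scal_mul_factorization hN hM hz hx hy hma hmb'
    rw [← hpB, ← hqB] at hfacB
    have hRpB : mapLin Φ (resolvent x a) = scal B N + scal B v * mapLin Φ p := by
      rw [hRp, mapLin_add, mapLin_scal_mul, mapLin_scal hΦ]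
    have hSqB : mapLin Φ (resolvent y b) = scal B N + scal B u * mapLin Φ q := by
      rw [hSq, mapLin_add, mapLin_scal_mul, mapLin_scal hΦ]
    rw [← hSqB] at h2
    rw [← hRpB] at h3
    have h3' : (1 - scal B z * (mapLin Φ p * mapLin Φ q)) * mapLin Φ V =
        mapLin Φ (resolvent x a) := by
      rw [_root_.sub_mul, one_mul, sub_eq_iff_eq_add]
      exact h3
    have hm : (1 - scal B z * (A₁ * B₁)) * mapLin Φ W = 1 := by
      calc _ = scal B M * (1 - scal B z * (A₁ * B₁)) * (scal B N * mapLin Φ W) := by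
            rw [scal_commute M, mul_assoc, ← mul_assoc (scal B M), ← map_mul, mul_comm M, hM,
              map_one, one_mul]
        _ = (1 - scal B x * A₁) * ((1 - scal B z * (mapLin Φ p * mapLin Φ q)) *
              (((1 - scal B y * B₁) * mapLin Φ (resolvent y b)) * mapLin Φ V)) := by
            rw [← hfacB, h2]
            simp only [mul_assoc]
        _ = 1 := by rw [hmb, one_mul, h3', hma]
    have hm' : (1 - scal B z * cFreeCumulantSeries Φ φ (a * b)) * mapLin Φ W = 1 := by
      have e1 := mapLin_resolvent_eq hΦ hz0 (a * b)
      rw [mapLin_C_mul_resolvent hφ hΦ hz0, hWN, hzN, sub_X_left, ← hW] at e1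
      rw [_root_.sub_mul, one_mul, mul_assoc, sub_eq_iff_eq_add]
      exact e1
    have e2 : scal B z * cFreeCumulantSeries Φ φ (a * b) = scal B z * (A₁ * B₁) := by
      have := congrArg (· * (1 - scal B z * cFreeCumulantSeries Φ φ (a * b))) hm
      simp only [mul_assoc, one_mul] at this
      rw [mul_one_sub_eq_one hz0 hm', mul_one] at this
      exact (sub_right_inj.1 this).symm
    have e3 : X * cFreeCumulantSeries Φ φ (a * b) = X * (A₁ * B₁) := by
      have := congrArg (scal B N * ·) e2
      simpa only [← mul_assoc, ← map_mul, mul_comm N z, hzN, scal_X] using this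
    ext n
    simpa only [coeff_succ_X_mul] using congrArg (coeff (n + 1)) e3

end Product

end CFree

end

theorem mainTheorem4 {A B : Type*} [NormedRing A] [NormedAlgebra ℂ A] [CompleteSpace A]
    [NormedRing B] [NormedAlgebra ℂ B] [CompleteSpace B]
    (φ : A →ₗ[ℂ] ℂ) (hφ : φ 1 = 1) (Φ : A →ₗ[ℂ] B) (hΦ : Φ 1 = 1)
    (X Y : A) (hXY : CFree.ElementsCFree Φ φ X Y) (n : ℕ) (hn : 0 < n) :
    CFree.freeCumulantOne φ n (X * Y) =
      ∑ γ : CFree.NC n,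
        (∏ C ∈ γ.blocks, CFree.freeCumulantOne φ C.card X) *
          ∏ D ∈ (CFree.Kr γ).blocks, CFree.freeCumulantOne φ D.card Y ∧
    CFree.cFreeCumulantOne Φ φ n (X * Y) =
      ∑ γ : CFree.NC n,
        ((∏ C ∈ γ.blocks.erase (γ.block ⟨0, hn⟩), CFree.freeCumulantOne φ C.card X) *
          ∏ D ∈ (CFree.Kr γ).blocks.erase ((CFree.Kr γ).block ⟨n - 1, Nat.sub_one_lt_of_lt hn⟩),
            CFree.freeCumulantOne φ D.card Y) •
        (CFree.cFreeCumulantOne Φ φ (γ.block ⟨0, hn⟩).card X *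
          CFree.cFreeCumulantOne Φ φ
            ((CFree.Kr γ).block ⟨n - 1, Nat.sub_one_lt_of_lt hn⟩).card Y) := by
  have h := CFree.cumulantSeries_mul hφ hΦ hXY
    (u := CFree.coGapSeries (fun k => CFree.freeCumulantOne φ k X)
      fun k => CFree.freeCumulantOne φ k Y)
    (v := CFree.gapSeries (fun k => CFree.freeCumulantOne φ k X)
      fun k => CFree.freeCumulantOne φ k Y)
    rfl (CFree.gapSeries_eq _ _)
  have hn' : n - 1 + 1 = n := Nat.sub_add_cancel hn
  constructor
  · have h1 := congrArg (PowerSeries.coeff (n - 1)) h.1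
    rw [CFree.freeCumulantSeries, PowerSeries.coeff_mk, hn'] at h1
    rw [h1]
    exact (CFree.krewerasSum_scalar_eq (fun k => CFree.freeCumulantOne φ k X)
      (fun k => CFree.freeCumulantOne φ k Y) n hn).symm
  · have h2 := congrArg (PowerSeries.coeff (n - 1)) h.2
    rw [CFree.cFreeCumulantSeries, PowerSeries.coeff_mk, hn'] at h2
    rw [h2]
    exact (CFree.krewerasSum_eq (fun k => CFree.freeCumulantOne φ k X)
      (fun k => CFree.freeCumulantOne φ k Y) (fun k => CFree.cFreeCumulantOne Φ φ k X)
      (fun k => CFree.cFreeCumulantOne Φ φ k Y) n hn).symm
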